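/- Let $n\in\mathbb{N}=\{0,1,2,\dots\}$ and $0<q<1$. All algebras are complex, associative and unital, and all $*$-homomorphisms are unital. Let $\mathcal{A}(S^{2n+1}_q)$ be the $*$-algebra generated by $z_0,\ldots,z_n$ and their adjoints with relations \begin{align*} z_jz_i &= q\,z_iz_j && (0\le i<j\le n), \\ z_i^*z_j &= q\,z_jz_i^* && (0\le i\neq j\le n), \\ z_i^*z_i &= z_iz_i^*+(1-q^2)\sum_{j=i+1}^n z_jz_j^* && (0\le i\le n), \\ \sum_{i=0}^n z_iz_i^* &= 1 , \end{align*} and let $C(S^{2n+1}_q)$ be its universal C*-algebra, with canonical $*$-homomorphism $\iota:\mathcal{A}(S^{2n+1}_q)\to C(S^{2n+1}_q)$ (every $*$-homomorphism from $\mathcal{A}(S^{2n+1}_q)$ to a C*-algebra factors uniquely through $\iota$). Let $\{|k_0,\ldots,k_n\rangle : (k_0,\ldots,k_n)\in\mathbb{N}^n\times\mathbb{Z}\}$ be the standard orthonormal basis of $\ell^2(\mathbb{N}^n\times\mathbb{Z})$, and let $\pi$ be the bounded $*$-representation of $\mathcal{A}(S^{2n+1}_q)$ on $\ell^2(\mathbb{N}^n\times\mathbb{Z})$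 given on generators by \begin{align*} \pi(z_i)|k_0,\ldots,k_n\rangle &= q^{k_0+\ldots+k_{i-1}}\sqrt{1-q^{2(k_i+1)}}\;|k_0,\ldots,k_i+1,\ldots,k_n\rangle && (0\le i<n), \\ \pi(z_n)|k_0,\ldots,k_n\rangle &= q^{k_0+\ldots+k_{n-1}}\;|k_0,\ldots,k_{n-1},k_n+1\rangle . \end{align*} Then $\pi$ extends uniquely to a representation of $C(S^{2n+1}_q)$, i.e. there is a unique $*$-homomorphism $\widetilde\pi:C(S^{2n+1}_q)\to\mathcal{B}(\ell^2(\mathbb{N}^n\times\mathbb{Z}))$ with $\widetilde\pi\circ\iota=\pi$, and $\widetilde\pi$ is faithful (equivalently, injective). -/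

import Mathlib

open scoped ComplexConjugate

namespace QSphere

/-! ## Universal C*-algebras of *-algebras

All algebras are complex, associative and unital; all *-homomorphisms are unital. -/

noncomputable section Universal

theorem continuous_starAlgHom {B C : Type*} [CStarAlgebra B] [CStarAlgebra C] (f : B →⋆ₐ[ℂ] C) :
    Continuous f :=
  AddMonoidHomClass.continuous_of_bound f 1 fun x => by
    simpa using NonUnitalStarAlgHom.norm_apply_le f x

/-- A C*-seminorm on a *-algebra: a submultiplicative seminorm satisfying the C*-identity. -/
structure CStarSeminorm (A : Type*) [Ring A] [StarRing A] [Algebra ℂ A] extends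
    Seminorm ℂ A where
  mul_le' : ∀ a b, toFun (a * b) ≤ toFun a * toFun b
  star_mul_self' : ∀ a, toFun (star a * a) = toFun a ^ 2

namespace CStarSeminorm

variable {A : Type*} [Ring A] [StarRing A] [Algebra ℂ A]

instance : CoeFun (CStarSeminorm A) (fun _ => A → ℝ) := ⟨fun p => p.toSeminorm⟩

theorem mul_le (p : CStarSeminorm A) (a b : A) : p (a * b) ≤ p a * p b := p.mul_le' a b

theorem star_mul_self (p : CStarSeminorm A) (a : A) : p (star a * a) = p a ^ 2 :=
  p.star_mul_self' a

theorem nonneg (p : CStarSeminorm A) (a : A) : 0 ≤ p a := apply_nonneg p.toSeminorm a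

theorem le_star (p : CStarSeminorm A) (a : A) : p a ≤ p (star a) := by
  have h := p.mul_le (star a) a
  rw [p.star_mul_self, sq] at h
  rcases (p.nonneg a).eq_or_lt with h0 | h0
  · rw [← h0]; exact p.nonneg _
  · exact le_of_mul_le_mul_right h h0

theorem star_eq (p : CStarSeminorm A) (a : A) : p (star a) = p a :=
  le_antisymm (by simpa using p.le_star (star a)) (p.le_star a)

theorem one_le (p : CStarSeminorm A) : p 1 ≤ 1 := by
  have h := p.star_mul_self 1
  rw [star_one, mul_one] at h
  nlinarith [p.nonneg 1, sq_nonneg (p 1 - 1)]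

/-- The zero C*-seminorm. -/
instance : Inhabited (CStarSeminorm A) where
  default :=
    { toFun := fun _ => 0
      map_zero' := rfl
      add_le' := fun a b => by simp
      neg' := fun a => rfl
      smul' := fun c a => by simp
      mul_le' := fun a b => by simp
      star_mul_self' := fun a => by simp }

/-- A C*-seminorm is obtained by pulling back the norm along a *-homomorphism to a C*-algebra. -/
def ofHom {C : Type*} [CStarAlgebra C] (f : A →⋆ₐ[ℂ] C) : CStarSeminorm A where
  toFun a := ‖f a‖
  map_zero' := by simp
  add_le' a b := by simpa using norm_add_le (f a) (f b)
  neg' a := by simp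
  smul' c a := by simp [norm_smul]
  mul_le' a b := by simpa using norm_mul_le (f a) (f b)
  star_mul_self' a := by
    rw [map_mul, map_star, CStarRing.norm_star_mul_self, sq]

theorem ofHom_apply {C : Type*} [CStarAlgebra C] (f : A →⋆ₐ[ℂ] C) (a : A) :
    ofHom f a = ‖f a‖ := rfl

/-- The algebra `A`, seen as a seminormed algebra through the C*-seminorm `p`. -/
def Pre (_p : CStarSeminorm A) : Type _ := A

variable (p : CStarSeminorm A)

instance : Ring p.Pre := inferInstanceAs (Ring A)
instance : StarRing p.Pre := inferInstanceAs (StarRing A)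
instance : Algebra ℂ p.Pre := inferInstanceAs (Algebra ℂ A)
instance [StarModule ℂ A] : StarModule ℂ p.Pre := inferInstanceAs (StarModule ℂ A)

instance : SeminormedRing p.Pre where
  norm a := p (show A from a)
  dist a b := p (show A from -a + b)
  dist_self a := (congrArg p (neg_add_cancel (show A from a))).trans (map_zero p.toSeminorm)
  dist_comm a b := by
    rw [← map_neg_eq_map p.toSeminorm]
    refine congrArg p ?_
    change -(-a + b : p.Pre) = -b + a
    rw [neg_add_rev, neg_neg]
  dist_triangle a b c := by
    refine le_trans (le_of_eq (congrArg p ?_)) (map_add_le_add p.toSeminorm (-a + b) (-b + c))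
    change (-a + c : p.Pre) = (-a + b) + (-b + c)
    abel
  dist_eq _ _ := rfl
  norm_mul_le := p.mul_le

theorem Pre.norm_eq (a : p.Pre) : ‖a‖ = p (show A from a) := rfl

instance : NormedAlgebra ℂ p.Pre where
  norm_smul_le c a := (map_smul_eq_mul p.toSeminorm c (show A from a)).le

theorem Pre.isometry_star : Isometry (star : p.Pre → p.Pre) :=
  AddMonoidHomClass.isometry_of_norm (starAddEquiv : p.Pre ≃+ p.Pre) (fun a => p.star_eq a)

/-- The C*-completion of `A` in the C*-seminorm `p`: the Hausdorff completion of `A`, that is, the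
completion of the quotient of `A` by the kernel of `p`. -/
def Compl : Type _ := UniformSpace.Completion p.Pre

instance : NormedRing p.Compl :=
  inferInstanceAs (NormedRing (UniformSpace.Completion p.Pre))

instance : CompleteSpace p.Compl :=
  inferInstanceAs (CompleteSpace (UniformSpace.Completion p.Pre))

instance : Algebra ℂ p.Compl :=
  inferInstanceAs (Algebra ℂ (UniformSpace.Completion p.Pre))

/-- The canonical map to the completion. -/
def incl (a : A) : p.Compl := ((show p.Pre from a : p.Pre) : UniformSpace.Completion p.Pre)

theorem norm_incl (a : A) : ‖p.incl a‖ = p a :=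
  UniformSpace.Completion.norm_coe (E := p.Pre) a

theorem denseRange_incl : DenseRange p.incl :=
  UniformSpace.Completion.denseRange_coe (α := p.Pre)

theorem incl_add (a b : A) : p.incl (a + b) = p.incl a + p.incl b :=
  UniformSpace.Completion.coe_add (α := p.Pre) a b

theorem incl_mul (a b : A) : p.incl (a * b) = p.incl a * p.incl b :=
  UniformSpace.Completion.coe_mul (α := p.Pre) a b

theorem incl_zero : p.incl 0 = 0 := rfl

theorem incl_one : p.incl 1 = 1 := rfl

theorem incl_smul (c : ℂ) (a : A) : p.incl (c • a) = c • p.incl a :=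
  UniformSpace.Completion.coe_smul (X := p.Pre) c a

theorem incl_algebraMap (c : ℂ) : p.incl (algebraMap ℂ A c) = algebraMap ℂ p.Compl c := by
  rw [Algebra.algebraMap_eq_smul_one, Algebra.algebraMap_eq_smul_one, incl_smul, incl_one]

instance : NormedAlgebra ℂ p.Compl where
  norm_smul_le c a :=
    norm_smul_le (α := ℂ) (β := UniformSpace.Completion p.Pre) c a

/-- Two continuous maps that agree on the image of `A` are equal. -/
theorem compl_ext {X : Type*} [TopologicalSpace X] [T2Space X] {f g : p.Compl → X}
    (hf : Continuous f) (hg : Continuous g) (h : ∀ a, f (p.incl a) = g (p.incl a)) : f = g :=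
  p.denseRange_incl.equalizer hf hg (funext h)

/-- The involution on the completion is the continuous extension of that of `A`. -/
instance : Star p.Compl :=
  ⟨UniformSpace.Completion.map (star : p.Pre → p.Pre)⟩

theorem continuous_compl_star : Continuous (star : p.Compl → p.Compl) :=
  UniformSpace.Completion.continuous_map

theorem incl_star (a : A) : p.incl (star a) = star (p.incl a) :=
  (UniformSpace.Completion.map_coe (Pre.isometry_star p).uniformContinuous a).symm

instance : StarRing p.Compl where
  star_involutive a := by
    have := p.continuous_compl_star
    exact congrFun (p.compl_ext (f := fun a => star (star a)) (g := id) (by fun_prop) (by fun_prop)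
      (fun a => by simp [← incl_star])) a
  star_mul a b := by
    have := p.continuous_compl_star
    refine p.denseRange_incl.induction_on₂
      (p := fun a b => star (a * b) = star b * star a) ?_ ?_ a b
    · exact isClosed_eq (by fun_prop) (by fun_prop)
    · intro a b; simp [← incl_star, ← incl_mul]
  star_add a b := by
    have := p.continuous_compl_star
    refine p.denseRange_incl.induction_on₂
      (p := fun a b => star (a + b) = star a + star b) ?_ ?_ a b
    · exact isClosed_eq (by fun_prop) (by fun_prop)
    · intro a b; simp [← incl_star, ← incl_add]

instance : CStarRing p.Compl where
  norm_mul_self_le a := by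
    have := p.continuous_compl_star
    refine le_of_eq (congrFun (p.compl_ext (f := fun a => ‖a‖ * ‖a‖)
      (g := fun a => ‖star a * a‖) (by fun_prop) (by fun_prop) (fun a => ?_)) a)
    simp [← incl_star, ← incl_mul, norm_incl, star_mul_self, sq]

/-- The canonical *-homomorphism to the completion. -/
def toCompl : A →⋆ₐ[ℂ] p.Compl where
  toFun := p.incl
  map_one' := p.incl_one
  map_mul' := p.incl_mul
  map_zero' := p.incl_zero
  map_add' := p.incl_add
  commutes' := p.incl_algebraMap
  map_star' := p.incl_star

theorem norm_toCompl (a : A) : ‖p.toCompl a‖ = p a := p.norm_incl a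

theorem denseRange_toCompl : DenseRange p.toCompl := p.denseRange_incl

/-- A *-homomorphism, seen on the seminormed algebra. -/
def onPre {C : Type*} [CStarAlgebra C] (f : A →⋆ₐ[ℂ] C) : p.Pre →+ C :=
  AddMonoidHomClass.toAddMonoidHom f

variable {p} in
theorem uniformContinuous_onPre {C : Type*} [CStarAlgebra C] {f : A →⋆ₐ[ℂ] C}
    (hf : ∀ a, ‖f a‖ ≤ p a) : UniformContinuous (p.onPre f) :=
  AddMonoidHomClass.uniformContinuous_of_bound (p.onPre f) 1 fun a => by
    rw [one_mul]; exact hf a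

variable [StarModule ℂ A]

instance : StarModule ℂ p.Compl where
  star_smul c a := by
    have h1 := p.continuous_compl_star
    have h2 : Continuous fun a : p.Compl => c • a := continuous_const_smul c
    have h3 : Continuous fun a : p.Compl => star c • a := continuous_const_smul (star c)
    refine congrFun (p.compl_ext (f := fun a => star (c • a)) (g := fun a => star c • star a)
      (h1.comp h2) (h3.comp h1) (fun a => ?_)) a
    rw [← p.incl_smul, ← p.incl_star, ← p.incl_star, ← p.incl_smul, star_smul]

instance : CStarAlgebra p.Compl where

variable {p} in
/-- A *-homomorphism to a C*-algebra that is bounded by `p` extends to the completion. -/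
def lift {C : Type*} [CStarAlgebra C] (f : A →⋆ₐ[ℂ] C) (hf : ∀ a, ‖f a‖ ≤ p a) :
    p.Compl →⋆ₐ[ℂ] C :=
  let F : p.Compl → C := UniformSpace.Completion.extension (p.onPre f)
  have hF : Continuous F := UniformSpace.Completion.continuous_extension
  have hFa : ∀ a, F (p.incl a) = f a :=
    UniformSpace.Completion.extension_coe (α := p.Pre) (uniformContinuous_onPre hf)
  have hs := p.continuous_compl_star
  { toFun := F
    map_one' := by rw [← p.incl_one, hFa, map_one]
    map_zero' := by rw [← p.incl_zero, hFa, map_zero]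
    map_mul' := fun a b => by
      refine p.denseRange_incl.induction_on₂ (p := fun a b => F (a * b) = F a * F b) ?_ ?_ a b
      · exact isClosed_eq (by fun_prop) (by fun_prop)
      · intro a b; rw [← p.incl_mul, hFa, hFa, hFa, map_mul]
    map_add' := fun a b => by
      refine p.denseRange_incl.induction_on₂ (p := fun a b => F (a + b) = F a + F b) ?_ ?_ a b
      · exact isClosed_eq (by fun_prop) (by fun_prop)
      · intro a b; rw [← p.incl_add, hFa, hFa, hFa, map_add]
    commutes' := fun c => by rw [← p.incl_algebraMap, hFa, AlgHomClass.commutes]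
    map_star' := fun a => congrFun (p.compl_ext (f := fun a => F (star a))
      (g := fun a => star (F a)) (by fun_prop) (by fun_prop)
      (fun a => by rw [← p.incl_star, hFa, hFa, map_star])) a }

theorem lift_toCompl {C : Type*} [CStarAlgebra C] (f : A →⋆ₐ[ℂ] C) (hf : ∀ a, ‖f a‖ ≤ p a)
    (a : A) : lift f hf (p.toCompl a) = f a :=
  UniformSpace.Completion.extension_coe (α := p.Pre) (uniformContinuous_onPre hf) a

end CStarSeminorm

/-- A *-algebra for which all C*-seminorms of any given element are bounded by a common constant,
so that a largest C*-seminorm exists. -/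
class HasUniversalCStar (A : Type*) [Ring A] [StarRing A] [Algebra ℂ A] : Prop where
  bdd : ∀ a : A, BddAbove (Set.range fun p : CStarSeminorm A => p a)

variable (A : Type*) [Ring A] [StarRing A] [Algebra ℂ A] [HasUniversalCStar A]

/-- The universal C*-seminorm: the largest C*-seminorm. By the Gelfand-Naimark theorem every
C*-seminorm has the form `‖ρ a‖` for a *-representation `ρ` by bounded operators on a Hilbert space,
so this is the supremum of the norms `‖ρ a‖` over all such `ρ`. -/
def universalSeminorm : CStarSeminorm A where
  toFun a := ⨆ p : CStarSeminorm A, p a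
  map_zero' := by simp
  add_le' a b := ciSup_le fun p => (map_add_le_add p.toSeminorm a b).trans
    (add_le_add (le_ciSup (HasUniversalCStar.bdd a) p) (le_ciSup (HasUniversalCStar.bdd b) p))
  neg' a := by simp
  smul' c a := by
    simp_rw [map_smul_eq_mul]
    exact (Real.mul_iSup_of_nonneg (norm_nonneg c) _).symm
  mul_le' a b := ciSup_le fun p => (p.mul_le a b).trans
    (mul_le_mul (le_ciSup (HasUniversalCStar.bdd a) p) (le_ciSup (HasUniversalCStar.bdd b) p)
      (p.nonneg b) ((p.nonneg a).trans (le_ciSup (HasUniversalCStar.bdd a) p)))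
  star_mul_self' a := by
    apply le_antisymm
    · refine ciSup_le fun p => ?_
      rw [p.star_mul_self]
      exact pow_le_pow_left₀ (p.nonneg a) (le_ciSup (HasUniversalCStar.bdd a) p) 2
    · rw [← Real.le_sqrt (Real.iSup_nonneg fun p => p.nonneg a)
        (Real.iSup_nonneg fun p => p.nonneg _)]
      refine ciSup_le fun p => Real.le_sqrt_of_sq_le ?_
      rw [← p.star_mul_self]
      exact le_ciSup (HasUniversalCStar.bdd (star a * a)) p

variable {A} in
theorem le_universalSeminorm (p : CStarSeminorm A) (a : A) : p a ≤ universalSeminorm A a :=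
  le_ciSup (HasUniversalCStar.bdd a) p

variable [StarModule ℂ A]

/-- The universal (enveloping) C*-algebra of a *-algebra: the completion in the universal
C*-seminorm. -/
abbrev UniversalCStar : Type _ := (universalSeminorm A).Compl

/-- The canonical *-homomorphism from a *-algebra to its universal C*-algebra. -/
abbrev toUniversal : A →⋆ₐ[ℂ] UniversalCStar A := (universalSeminorm A).toCompl

variable {A} in
/-- The universal property: every *-homomorphism to a C*-algebra extends uniquely. -/
theorem universal_property {C : Type*} [CStarAlgebra C] (f : A →⋆ₐ[ℂ] C) :
    ∃! g : UniversalCStar A →⋆ₐ[ℂ] C, g.comp (toUniversal A) = f := by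
  refine ⟨CStarSeminorm.lift f (le_universalSeminorm (CStarSeminorm.ofHom f)),
    StarAlgHom.ext
      (CStarSeminorm.lift_toCompl _ f (le_universalSeminorm (CStarSeminorm.ofHom f))),
    fun g hg => ?_⟩
  refine StarAlgHom.ext (congrFun ((universalSeminorm A).compl_ext ?_ ?_ fun a => ?_))
  · exact continuous_starAlgHom g
  · exact continuous_starAlgHom (CStarSeminorm.lift f _)
  · exact (DFunLike.congr_fun hg a).trans
      (CStarSeminorm.lift_toCompl _ f (le_universalSeminorm (CStarSeminorm.ofHom f)) a).symm

end Universal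

/-! ## The coordinate algebra of a quantum sphere -/

noncomputable section Coordinate

/-- The letters `z 0, …, z n` and `z 0 *, …, z n *`. -/
inductive Letter (n : ℕ) : Type
  | z (i : Fin (n + 1))
  | zStar (i : Fin (n + 1))

/-- The generator `z i` of the free algebra. -/
abbrev freeZ {n : ℕ} (i : Fin (n + 1)) : FreeAlgebra ℂ (Letter n) := FreeAlgebra.ι ℂ (.z i)

/-- The generator `z i *` of the free algebra. -/
abbrev freeZStar {n : ℕ} (i : Fin (n + 1)) : FreeAlgebra ℂ (Letter n) :=
  FreeAlgebra.ι ℂ (.zStar i)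

/-- The defining relations of the coordinate algebra of the quantum sphere, together with the
adjoints of the first family (the other families are closed under adjoints). -/
inductive SphereRel (n : ℕ) (q : ℝ) :
    FreeAlgebra ℂ (Letter n) → FreeAlgebra ℂ (Letter n) → Prop
  | comm (i j : Fin (n + 1)) (h : i < j) :
      SphereRel n q (freeZ j * freeZ i) ((q : ℂ) • (freeZ i * freeZ j))
  | comm_star (i j : Fin (n + 1)) (h : i < j) :
      SphereRel n q (freeZStar i * freeZStar j) ((q : ℂ) • (freeZStar j * freeZStar i))
  | cross (i j : Fin (n + 1)) (h : i ≠ j) :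
      SphereRel n q (freeZStar i * freeZ j) ((q : ℂ) • (freeZ j * freeZStar i))
  | diag (i : Fin (n + 1)) :
      SphereRel n q (freeZStar i * freeZ i)
        (freeZ i * freeZStar i +
          (1 - (q : ℂ) ^ 2) • ∑ j ∈ Finset.Ioi i, freeZ j * freeZStar j)
  | sphere : SphereRel n q (∑ i, freeZ i * freeZStar i) 1

/-- The coordinate algebra `𝒜(S_q^{2n+1})`. -/
def CoordAlg (n : ℕ) (q : ℝ) : Type := RingQuot (SphereRel n q)

namespace CoordAlg

variable {n : ℕ} {q : ℝ}

instance : Ring (CoordAlg n q) := inferInstanceAs (Ring (RingQuot (SphereRel n q)))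
instance : Algebra ℂ (CoordAlg n q) := inferInstanceAs (Algebra ℂ (RingQuot (SphereRel n q)))

/-- The quotient map from the free algebra. -/
def quot : FreeAlgebra ℂ (Letter n) →ₐ[ℂ] CoordAlg n q := RingQuot.mkAlgHom ℂ (SphereRel n q)

theorem quot_surjective : Function.Surjective (quot : _ →ₐ[ℂ] CoordAlg n q) :=
  RingQuot.mkAlgHom_surjective ℂ (SphereRel n q)

theorem quot_rel {a b : FreeAlgebra ℂ (Letter n)} (h : SphereRel n q a b) :
    (quot a : CoordAlg n q) = quot b := RingQuot.mkAlgHom_rel ℂ h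

/-- The generator `z i`. -/
def z (i : Fin (n + 1)) : CoordAlg n q := quot (freeZ i)

/-- The generator `z i *`; it is the adjoint of `z i`, see `star_z`. -/
def zs (i : Fin (n + 1)) : CoordAlg n q := quot (freeZStar i)

theorem rel_comm {i j : Fin (n + 1)} (h : i < j) :
    (z j * z i : CoordAlg n q) = (q : ℂ) • (z i * z j) := by
  simpa only [z, map_mul, map_smul] using quot_rel (SphereRel.comm (q := q) i j h)

theorem rel_comm_star {i j : Fin (n + 1)} (h : i < j) :
    (zs i * zs j : CoordAlg n q) = (q : ℂ) • (zs j * zs i) := by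
  simpa only [zs, map_mul, map_smul] using quot_rel (SphereRel.comm_star (q := q) i j h)

theorem rel_cross {i j : Fin (n + 1)} (h : i ≠ j) :
    (zs i * z j : CoordAlg n q) = (q : ℂ) • (z j * zs i) := by
  simpa only [z, zs, map_mul, map_smul] using quot_rel (SphereRel.cross (q := q) i j h)

theorem rel_diag (i : Fin (n + 1)) :
    (zs i * z i : CoordAlg n q) =
      z i * zs i + (1 - (q : ℂ) ^ 2) • ∑ j ∈ Finset.Ioi i, z j * zs j := by
  simpa only [z, zs, map_mul, map_add, map_smul, map_sum] using quot_rel (SphereRel.diag (q := q) i)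

theorem rel_sphere : (∑ i, z i * zs i : CoordAlg n q) = 1 := by
  simpa only [z, zs, map_mul, map_sum, map_one] using quot_rel (SphereRel.sphere (n := n) (q := q))

/-- Algebra homomorphisms out of the coordinate algebra. -/
def liftAlg {B : Type*} [Ring B] [Algebra ℂ B] (u v : Fin (n + 1) → B)
    (hc : ∀ i j, i < j → u j * u i = (q : ℂ) • (u i * u j))
    (hc' : ∀ i j, i < j → v i * v j = (q : ℂ) • (v j * v i))
    (hx : ∀ i j, i ≠ j → v i * u j = (q : ℂ) • (u j * v i))
    (hd : ∀ i, v i * u i = u i * v i + (1 - (q : ℂ) ^ 2) • ∑ j ∈ Finset.Ioi i, u j * v j)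
    (hs : ∑ i, u i * v i = 1) : CoordAlg n q →ₐ[ℂ] B :=
  RingQuot.liftAlgHom ℂ (s := SphereRel n q)
    ⟨FreeAlgebra.lift ℂ (fun l => match l with | .z i => u i | .zStar i => v i), by
      intro a b h
      cases h with
      | comm i j h =>
        simpa only [map_mul, map_smul, FreeAlgebra.lift_ι_apply] using hc i j h
      | comm_star i j h =>
        simpa only [map_mul, map_smul, FreeAlgebra.lift_ι_apply] using hc' i j h
      | cross i j h =>
        simpa only [map_mul, map_smul, FreeAlgebra.lift_ι_apply] using hx i j h
      | diag i =>
        simpa only [map_mul, map_add, map_smul, map_sum, FreeAlgebra.lift_ι_apply] using hd i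
      | sphere =>
        simpa only [map_mul, map_one, map_sum, FreeAlgebra.lift_ι_apply] using hs⟩

section lift

variable {B : Type*} [Ring B] [Algebra ℂ B] {u v : Fin (n + 1) → B}
    (hc : ∀ i j, i < j → u j * u i = (q : ℂ) • (u i * u j))
    (hc' : ∀ i j, i < j → v i * v j = (q : ℂ) • (v j * v i))
    (hx : ∀ i j, i ≠ j → v i * u j = (q : ℂ) • (u j * v i))
    (hd : ∀ i, v i * u i = u i * v i + (1 - (q : ℂ) ^ 2) • ∑ j ∈ Finset.Ioi i, u j * v j)
    (hs : ∑ i, u i * v i = 1)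

theorem liftAlg_z (i : Fin (n + 1)) : liftAlg u v hc hc' hx hd hs (z i) = u i := by
  simp only [liftAlg, z, quot]
  exact (RingQuot.liftAlgHom_mkAlgHom_apply _ _ _ _).trans (FreeAlgebra.lift_ι_apply _ _)

theorem liftAlg_zs (i : Fin (n + 1)) : liftAlg u v hc hc' hx hd hs (zs i) = v i := by
  simp only [liftAlg, zs, quot]
  exact (RingQuot.liftAlgHom_mkAlgHom_apply _ _ _ _).trans (FreeAlgebra.lift_ι_apply _ _)

end lift

/-- Induction principle. -/
theorem induction {P : CoordAlg n q → Prop} (halg : ∀ c : ℂ, P (algebraMap ℂ _ c))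
    (hz : ∀ i, P (z i)) (hzs : ∀ i, P (zs i)) (hmul : ∀ a b, P a → P b → P (a * b))
    (hadd : ∀ a b, P a → P b → P (a + b)) (a : CoordAlg n q) : P a := by
  obtain ⟨x, rfl⟩ := quot_surjective a
  induction x using FreeAlgebra.induction with
  | grade0 c => rw [AlgHom.commutes]; exact halg c
  | grade1 l => cases l with
    | z i => exact hz i
    | zStar i => exact hzs i
  | mul a b ha hb => rw [map_mul]; exact hmul _ _ ha hb
  | add a b ha hb => rw [map_add]; exact hadd _ _ ha hb

/-- The opposite algebra, with complex conjugate scalar multiplication. -/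
def ConjOp (B : Type*) : Type _ := Bᵐᵒᵖ

instance (B : Type*) [Ring B] : Ring (ConjOp B) := inferInstanceAs (Ring Bᵐᵒᵖ)

instance (B : Type*) [Ring B] [Algebra ℂ B] : Algebra ℂ (ConjOp B) :=
  ((algebraMap ℂ Bᵐᵒᵖ).comp (starRingEnd ℂ)).toAlgebra' fun c x => by
    exact Algebra.commutes (A := Bᵐᵒᵖ) (conj c) x

theorem ConjOp.smul_real {B : Type*} [Ring B] [Algebra ℂ B] (c : ℂ) (hc : conj c = c) (x : B) :
    c • (show ConjOp B from MulOpposite.op x) = (show ConjOp B from MulOpposite.op (c • x)) := by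
  rw [Algebra.smul_def]
  change algebraMap ℂ Bᵐᵒᵖ (conj c) * MulOpposite.op x = MulOpposite.op (c • x)
  rw [hc, ← Algebra.smul_def, MulOpposite.op_smul]

/-- The involution as an algebra homomorphism. -/
def starHom : CoordAlg n q →ₐ[ℂ] ConjOp (CoordAlg n q) :=
  liftAlg (fun i => (MulOpposite.op (zs i) : (CoordAlg n q)ᵐᵒᵖ))
    (fun i => (MulOpposite.op (z i) : (CoordAlg n q)ᵐᵒᵖ))
    (fun i j h => by
      refine Eq.trans ?_ (ConjOp.smul_real (q : ℂ) (Complex.conj_ofReal q) (zs j * zs i)).symm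
      exact congrArg MulOpposite.op (rel_comm_star h))
    (fun i j h => by
      refine Eq.trans ?_ (ConjOp.smul_real (q : ℂ) (Complex.conj_ofReal q) (z i * z j)).symm
      exact congrArg MulOpposite.op (rel_comm h))
    (fun i j h => by
      refine Eq.trans ?_ (ConjOp.smul_real (q : ℂ) (Complex.conj_ofReal q) (z i * zs j)).symm
      exact congrArg MulOpposite.op (rel_cross h.symm))
    (fun i => by
      have h := ConjOp.smul_real (1 - (q : ℂ) ^ 2) (by simp)
        (∑ j ∈ Finset.Ioi i, z j * zs j : CoordAlg n q)
      have h2 := congrArg MulOpposite.op (rel_diag (q := q) i)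
      rw [MulOpposite.op_add] at h2
      refine Eq.trans h2 ?_
      refine congrArg₂ (fun a b : (CoordAlg n q)ᵐᵒᵖ => a + b) rfl ?_
      refine Eq.trans h.symm (congrArg (fun a : ConjOp (CoordAlg n q) => (1 - (q : ℂ) ^ 2) • a) ?_)
      exact map_sum (MulOpposite.opAddEquiv (α := CoordAlg n q)) _ _)
    (by
      refine Eq.trans (map_sum (MulOpposite.opAddEquiv (α := CoordAlg n q)) _ _).symm ?_
      exact congrArg MulOpposite.op rel_sphere)

instance : Star (CoordAlg n q) :=
  ⟨fun a => MulOpposite.unop (show (CoordAlg n q)ᵐᵒᵖ from starHom a)⟩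

theorem star_z (i : Fin (n + 1)) : star (z i : CoordAlg n q) = zs i :=
  congrArg MulOpposite.unop (liftAlg_z (B := ConjOp (CoordAlg n q)) _ _ _ _ _ i)

theorem star_zs (i : Fin (n + 1)) : star (zs i : CoordAlg n q) = z i :=
  congrArg MulOpposite.unop (liftAlg_zs (B := ConjOp (CoordAlg n q)) _ _ _ _ _ i)

theorem star_mul_aux (a b : CoordAlg n q) : star (a * b) = star b * star a :=
  congrArg MulOpposite.unop (map_mul starHom a b)

theorem star_add_aux (a b : CoordAlg n q) : star (a + b) = star a + star b :=
  congrArg MulOpposite.unop (map_add starHom a b)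

theorem star_algebraMap (c : ℂ) :
    star (algebraMap ℂ (CoordAlg n q) c) = algebraMap ℂ _ (conj c) :=
  congrArg MulOpposite.unop (AlgHom.commutes starHom c)

/-- The *-structure of the coordinate algebra: the conjugate-linear anti-multiplicative
involution that exchanges the generators `z i` and `z i *`. -/
instance : StarRing (CoordAlg n q) where
  star_involutive a := by
    induction a using CoordAlg.induction with
    | halg c => simp [star_algebraMap]
    | hz i => rw [star_z, star_zs]
    | hzs i => rw [star_zs, star_z]
    | hmul a b ha hb => rw [star_mul_aux, star_mul_aux, ha, hb]
    | hadd a b ha hb => rw [star_add_aux, star_add_aux, ha, hb]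
  star_mul := star_mul_aux
  star_add := star_add_aux

instance : StarModule ℂ (CoordAlg n q) where
  star_smul c a := by
    rw [Algebra.smul_def, star_mul, star_algebraMap, ← Algebra.commutes, ← Algebra.smul_def]
    rfl

theorem norm_z_le {C : Type*} [CStarAlgebra C] (f : CoordAlg n q →⋆ₐ[ℂ] C) (i : Fin (n + 1)) :
    ‖f (z i)‖ ≤ 1 := by
  let _ := CStarAlgebra.spectralOrder C
  have _ := CStarAlgebra.spectralOrderedRing C
  have h1 : ∑ j, f (z j) * star (f (z j)) = 1 := by
    have h := congrArg f (rel_sphere (n := n) (q := q))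
    rw [map_sum, map_one] at h
    simpa only [map_mul, ← star_z, map_star] using h
  have h2 : f (z i) * star (f (z i)) ≤ 1 := by
    rw [← h1]
    exact Finset.single_le_sum (f := fun j => f (z j) * star (f (z j)))
      (fun j _ => mul_star_self_nonneg _) (Finset.mem_univ i)
  have h3 : ‖f (z i) * star (f (z i))‖ ≤ 1 :=
    (CStarAlgebra.norm_le_one_iff_of_nonneg _ (mul_star_self_nonneg _)).2 h2
  rw [CStarRing.norm_self_mul_star] at h3
  nlinarith [norm_nonneg (f (z i))]

theorem seminorm_z_le (p : CStarSeminorm (CoordAlg n q)) (i : Fin (n + 1)) : p (z i) ≤ 1 := by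
  rw [← p.norm_toCompl]
  exact norm_z_le p.toCompl i

instance : HasUniversalCStar (CoordAlg n q) where
  bdd a := by
    suffices h : ∃ K : ℝ, ∀ p : CStarSeminorm (CoordAlg n q), p a ≤ K by
      obtain ⟨K, hK⟩ := h
      exact ⟨K, by rintro _ ⟨p, rfl⟩; exact hK p⟩
    induction a using CoordAlg.induction with
    | halg c =>
      refine ⟨‖c‖, fun p => ?_⟩
      rw [Algebra.algebraMap_eq_smul_one, map_smul_eq_mul]
      exact mul_le_of_le_one_right (norm_nonneg c) p.one_le
    | hz i => exact ⟨1, fun p => seminorm_z_le p i⟩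
    | hzs i => exact ⟨1, fun p => by rw [← star_z, p.star_eq]; exact seminorm_z_le p i⟩
    | hmul a b ha hb =>
      obtain ⟨K, hK⟩ := ha
      obtain ⟨L, hL⟩ := hb
      exact ⟨K * L, fun p => (p.mul_le a b).trans
        (mul_le_mul (hK p) (hL p) (p.nonneg b) ((p.nonneg a).trans (hK p)))⟩
    | hadd a b ha hb =>
      obtain ⟨K, hK⟩ := ha
      obtain ⟨L, hL⟩ := hb
      exact ⟨K + L, fun p => (map_add_le_add p.toSeminorm a b).trans (add_le_add (hK p) (hL p))⟩

end CoordAlg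

/-- The C*-algebra `C(S_q^{2n+1})` of the quantum sphere: the universal C*-algebra of the coordinate
algebra. -/
abbrev CSphere (n : ℕ) (q : ℝ) : Type := UniversalCStar (CoordAlg n q)

end Coordinate

/-! ## The representation on `ℓ²(ℕⁿ × ℤ)` -/

noncomputable section Representation

/-- The index set `ℕⁿ × ℤ` of the standard basis; for `k : Idx n`, the labels are
`k.1 0, …, k.1 (n - 1)` and `k.2`. -/
abbrev Idx (n : ℕ) : Type := (Fin n → ℕ) × ℤ

/-- The Hilbert space `ℓ²(ℕⁿ × ℤ)`. -/
abbrev HSpace (n : ℕ) : Type := lp (fun _ : Idx n => ℂ) 2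

/-- The standard basis vector of `ℓ²(ℕⁿ × ℤ)` with label `k`. -/
def ket {n : ℕ} (k : Idx n) : HSpace n := lp.single 2 k (1 : ℂ)

variable {n : ℕ}

theorem ket_apply (k j : Idx n) : ket k j = if j = k then 1 else 0 := by
  rw [ket, lp.single_apply, Pi.single_apply]

theorem inner_ket_left (k : Idx n) (f : HSpace n) : inner ℂ (ket k) f = f k := by
  rw [ket, lp.inner_single_left]
  simp

theorem orthonormal_ket : Orthonormal ℂ (ket : Idx n → HSpace n) := by
  rw [orthonormal_iff_ite]
  intro i j
  rw [inner_ket_left, ket_apply]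

theorem mul_op_apply (S T : HSpace n →L[ℂ] HSpace n) (v : HSpace n) : (S * T) v = S (T v) := rfl

theorem smul_op_apply (c : ℂ) (S : HSpace n →L[ℂ] HSpace n) (v : HSpace n) :
    (c • S) v = c • S v := rfl

theorem op_ext {S T : HSpace n →L[ℂ] HSpace n} (h : ∀ k, S (ket k) = T (ket k)) : S = T := by
  refine lp.ext_continuousLinearMap (by norm_num) fun k => ?_
  ext1
  exact h k

/-- The diagonal operator with diagonal entries `w`. -/
def diagOp (w : Idx n → ℝ) (hw : ∀ k, |w k| ≤ 1) : HSpace n →L[ℂ] HSpace n :=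
  have hle : ∀ (f : HSpace n) (k : Idx n), ‖(w k : ℂ) * f k‖ ≤ ‖f k‖ := fun f k => by
    rw [norm_mul, Complex.norm_real]
    exact mul_le_of_le_one_left (norm_nonneg _) (hw k)
  LinearMap.mkContinuous
    { toFun := fun f => ⟨fun k => (w k : ℂ) * f k, (lp.memℓp f).mono' (hle f)⟩
      map_add' := fun f g => by ext k; exact mul_add _ _ _
      map_smul' := fun c f => by ext k; exact mul_left_comm _ _ _ } 1
    (fun f => by
      rw [one_mul]
      exact lp.norm_mono (by norm_num) (hle f))

theorem diagOp_ket (w : Idx n → ℝ) (hw : ∀ k, |w k| ≤ 1) (k : Idx n) :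
    diagOp w hw (ket k) = (w k : ℂ) • ket k := by
  ext j
  change (w j : ℂ) * ket k j = (w k : ℂ) * ket k j
  rw [ket_apply]
  split_ifs with h
  · rw [h]
  · simp

/-- The isometry that permutes the standard basis vectors by the injective map `σ`. -/
def shiftOp (σ : Idx n → Idx n) (hσ : Function.Injective σ) : HSpace n →L[ℂ] HSpace n :=
  ((orthonormal_ket.comp σ hσ).orthogonalFamily.linearIsometry).toContinuousLinearMap

theorem shiftOp_ket (σ : Idx n → Idx n) (hσ : Function.Injective σ) (k : Idx n) :
    shiftOp σ hσ (ket k) = ket (σ k) := by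
  refine ((orthonormal_ket.comp σ hσ).orthogonalFamily.linearIsometry_apply_single
    (1 : ℂ)).trans ?_
  simp

/-- Raise by one the label of index `i`. -/
def raise (i : Fin (n + 1)) (k : Idx n) : Idx n :=
  Fin.lastCases (motive := fun _ => Idx n) (k.1, k.2 + 1)
    (fun i => (Function.update k.1 i (k.1 i + 1), k.2)) i

/-- Lower by one the label of index `i` (a natural label that is zero stays the same). -/
def lower (i : Fin (n + 1)) (k : Idx n) : Idx n :=
  Fin.lastCases (motive := fun _ => Idx n) (k.1, k.2 - 1)
    (fun i => (Function.update k.1 i (k.1 i - 1), k.2)) i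

@[simp] theorem raise_last (k : Idx n) : raise (Fin.last n) k = (k.1, k.2 + 1) := by
  simp [raise]

@[simp] theorem raise_castSucc (i : Fin n) (k : Idx n) :
    raise i.castSucc k = (Function.update k.1 i (k.1 i + 1), k.2) := by
  simp [raise]

@[simp] theorem lower_last (k : Idx n) : lower (Fin.last n) k = (k.1, k.2 - 1) := by
  simp [lower]

@[simp] theorem lower_castSucc (i : Fin n) (k : Idx n) :
    lower i.castSucc k = (Function.update k.1 i (k.1 i - 1), k.2) := by
  simp [lower]

theorem lower_raise (i : Fin (n + 1)) (k : Idx n) : lower i (raise i k) = k := by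
  induction i using Fin.lastCases <;> simp

theorem raise_injective (i : Fin (n + 1)) : Function.Injective (raise i : Idx n → Idx n) :=
  Function.LeftInverse.injective (lower_raise i)

/-- The sum `k_0 + … + k_{i-1}`. -/
def psum (i : Fin (n + 1)) (k : Idx n) : ℕ := ∑ j : Fin n with j.castSucc < i, k.1 j

/-- The coefficient `q^{k_0 + … + k_{i-1}} √(1 - q^{2 (k_i + 1)})` for `i < n`, and
`q^{k_0 + … + k_{n-1}}` for `i = n`. -/
def weight (q : ℝ) (i : Fin (n + 1)) (k : Idx n) : ℝ :=
  q ^ psum i k * Fin.lastCases (motive := fun _ => ℝ) 1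
    (fun i => √(1 - q ^ (2 * (k.1 i + 1)))) i

theorem abs_weight_le {q : ℝ} (hq0 : 0 ≤ q) (hq1 : q < 1) (i : Fin (n + 1)) (k : Idx n) :
    |weight q i k| ≤ 1 := by
  have h1 : |q ^ psum i k| ≤ 1 := by
    rw [abs_of_nonneg (by positivity)]; exact pow_le_one₀ hq0 hq1.le
  rw [weight, abs_mul]
  refine mul_le_one₀ h1 (abs_nonneg _) ?_
  induction i using Fin.lastCases with
  | last => simp
  | cast i =>
    rw [Fin.lastCases_castSucc, abs_of_nonneg (Real.sqrt_nonneg _)]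
    exact Real.sqrt_le_one.2 (by have := pow_nonneg hq0 (2 * (k.1 i + 1)); linarith)

/-- The operator `π(z i)`: it maps `|k⟩` to `weight q i k • |k with k_i raised by one⟩`, see
`zOp_ket`. -/
def zOp {q : ℝ} (hq0 : 0 ≤ q) (hq1 : q < 1) (i : Fin (n + 1)) : HSpace n →L[ℂ] HSpace n :=
  shiftOp (raise i) (raise_injective i) ∘L diagOp (weight q i) (abs_weight_le hq0 hq1 i)

variable {q : ℝ} (hq0 : 0 ≤ q) (hq1 : q < 1)

theorem zOp_ket (i : Fin (n + 1)) (k : Idx n) :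
    zOp hq0 hq1 i (ket k) = (weight q i k : ℂ) • ket (raise i k) := by
  rw [zOp, ContinuousLinearMap.comp_apply, diagOp_ket, map_smul, shiftOp_ket]

theorem zOp_ket_castSucc (i : Fin n) (k : Idx n) :
    zOp hq0 hq1 i.castSucc (ket k) =
      ((q ^ (∑ j ∈ Finset.Iio i, k.1 j) * √(1 - q ^ (2 * (k.1 i + 1))) : ℝ) : ℂ) •
        ket (Function.update k.1 i (k.1 i + 1), k.2) := by
  rw [zOp_ket, raise_castSucc, weight, Fin.lastCases_castSucc, psum]
  congr 5
  ext j
  simp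

theorem zOp_ket_last (k : Idx n) :
    zOp hq0 hq1 (Fin.last n) (ket k) = ((q ^ (∑ j, k.1 j) : ℝ) : ℂ) • ket (k.1, k.2 + 1) := by
  rw [zOp_ket, raise_last, weight, Fin.lastCases_last, psum, mul_one]
  congr 4
  ext j
  simp [Fin.castSucc_lt_last]

/-- The coefficients of the adjoint of `π(z i)`. -/
def coweight (q : ℝ) (i : Fin (n + 1)) (k : Idx n) : ℝ :=
  q ^ psum i k * Fin.lastCases (motive := fun _ => ℝ) 1 (fun i => √(1 - q ^ (2 * k.1 i))) i

theorem psum_raise_of_le {i j : Fin (n + 1)} (h : i ≤ j) (k : Idx n) :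
    psum i (raise j k) = psum i k := by
  refine Finset.sum_congr rfl fun l hl => ?_
  have hl' := (Finset.mem_filter.1 hl).2
  induction j using Fin.lastCases with
  | last => simp
  | cast j =>
    have : l ≠ j := by rintro rfl; exact absurd (lt_of_lt_of_le hl' h) (lt_irrefl _)
    simp [this]

theorem psum_raise_of_lt {i j : Fin (n + 1)} (h : i < j) (k : Idx n) :
    psum j (raise i k) = psum j k + 1 := by
  induction i using Fin.lastCases with
  | last => exact absurd h (not_lt.2 (Fin.le_last j))
  | cast i =>
    have hi : i ∈ Finset.univ.filter (fun l : Fin n => l.castSucc < j) := by simpa using h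
    rw [psum, psum, ← Finset.add_sum_erase _ _ hi, ← Finset.add_sum_erase _ _ hi]
    rw [raise_castSucc]
    have : ∑ x ∈ (Finset.univ.filter (fun l : Fin n => l.castSucc < j)).erase i,
        Function.update k.1 i (k.1 i + 1) x =
        ∑ x ∈ (Finset.univ.filter (fun l : Fin n => l.castSucc < j)).erase i, k.1 x :=
      Finset.sum_congr rfl fun x hx => by simp [(Finset.mem_erase.1 hx).1]
    simp only [Function.update_self, this]
    omega

theorem coweight_raise (i : Fin (n + 1)) (k : Idx n) :
    coweight q i (raise i k) = weight q i k := by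
  rw [coweight, weight, psum_raise_of_le le_rfl]
  induction i using Fin.lastCases <;> simp

theorem coweight_eq_zero {i : Fin (n + 1)} {k : Idx n} (h : raise i (lower i k) ≠ k) :
    coweight q i k = 0 := by
  induction i using Fin.lastCases with
  | last => simp at h
  | cast i =>
    have hk : k.1 i = 0 := by
      by_contra hk
      apply h
      ext1
      · ext l
        by_cases hl : l = i
        · subst hl; simp; omega
        · simp [hl]
      · simp
    simp [coweight, hk]

theorem adjoint_zOp_ket (i : Fin (n + 1)) (k : Idx n) :
    star (zOp hq0 hq1 i) (ket k) = (coweight q i k : ℂ) • ket (lower i k) := by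
  ext j
  rw [← inner_ket_left j, ContinuousLinearMap.star_eq_adjoint,
    ContinuousLinearMap.adjoint_inner_right, zOp_ket, inner_smul_left, inner_ket_left, ket_apply,
    lp.coeFn_smul, Pi.smul_apply, ket_apply, Complex.conj_ofReal, smul_eq_mul]
  by_cases h1 : raise i j = k
  · subst h1
    simp [lower_raise, coweight_raise]
  · by_cases h2 : j = lower i k
    · subst h2
      simp [h1, coweight_eq_zero h1]
    · simp [h1, h2]

theorem weight_raise_of_ne {i j : Fin (n + 1)} (h : i < j) (k : Idx n) :
    weight q j (raise i k) = q * weight q j k ∧ weight q i (raise j k) = weight q i k ∧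
      coweight q i (raise j k) = coweight q i k := by
  refine ⟨?_, ?_, ?_⟩
  · rw [weight, weight, psum_raise_of_lt h, pow_succ]
    induction i using Fin.lastCases with
    | last => exact absurd h (not_lt.2 (Fin.le_last j))
    | cast i =>
      induction j using Fin.lastCases with
      | last => simp; ring
      | cast j =>
        have : j ≠ i := by rintro rfl; exact lt_irrefl _ h
        simp [this]; ring
  · rw [weight, weight, psum_raise_of_le h.le]
    induction i using Fin.lastCases with
    | last => exact absurd h (not_lt.2 (Fin.le_last j))
    | cast i =>
      induction j using Fin.lastCases with
      | last => simp
      | cast j =>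
        have : i ≠ j := by rintro rfl; exact lt_irrefl _ h
        simp [this]
  · rw [coweight, coweight, psum_raise_of_le h.le]
    induction i using Fin.lastCases with
    | last => exact absurd h (not_lt.2 (Fin.le_last j))
    | cast i =>
      induction j using Fin.lastCases with
      | last => simp
      | cast j =>
        have : i ≠ j := by rintro rfl; exact lt_irrefl _ h
        simp [this]

theorem raise_raise {i j : Fin (n + 1)} (h : i < j) (k : Idx n) :
    raise j (raise i k) = raise i (raise j k) := by
  induction i using Fin.lastCases with
  | last => exact absurd h (not_lt.2 (Fin.le_last j))
  | cast i =>
    induction j using Fin.lastCases with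
    | last => simp
    | cast j =>
      have h1 : j ≠ i := by rintro rfl; exact lt_irrefl _ h
      simp [h1, h1.symm, Function.update_comm h1]

theorem lower_raise_of_lt {i j : Fin (n + 1)} (h : i < j) (k : Idx n) :
    lower i (raise j k) = raise j (lower i k) := by
  induction i using Fin.lastCases with
  | last => exact absurd h (not_lt.2 (Fin.le_last j))
  | cast i =>
    induction j using Fin.lastCases with
    | last => simp
    | cast j =>
      have h1 : j ≠ i := by rintro rfl; exact lt_irrefl _ h
      simp [h1, h1.symm, Function.update_comm h1]

theorem zOp_comm {i j : Fin (n + 1)} (h : i < j) :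
    zOp hq0 hq1 j * zOp hq0 hq1 i = (q : ℂ) • (zOp (n := n) hq0 hq1 i * zOp hq0 hq1 j) := by
  refine op_ext fun k => ?_
  simp only [smul_op_apply, mul_op_apply, zOp_ket, map_smul,
    smul_smul, raise_raise h, (weight_raise_of_ne h k).1, (weight_raise_of_ne h k).2.1]
  congr 1
  push_cast
  ring

theorem zOp_cross {i j : Fin (n + 1)} (h : i < j) :
    star (zOp hq0 hq1 i) * zOp hq0 hq1 j =
      (q : ℂ) • (zOp (n := n) hq0 hq1 j * star (zOp hq0 hq1 i)) := by
  refine op_ext fun k => ?_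
  simp only [smul_op_apply, mul_op_apply, zOp_ket, map_smul,
    smul_smul, adjoint_zOp_ket, lower_raise_of_lt h, (weight_raise_of_ne h k).2.2]
  congr 1
  by_cases h1 : raise i (lower i k) = k
  · have := (weight_raise_of_ne (q := q) h (lower i k)).1
    rw [h1] at this
    rw [this]
    push_cast
    ring
  · simp [coweight_eq_zero h1]

theorem zOp_comm_star {i j : Fin (n + 1)} (h : i < j) :
    star (zOp hq0 hq1 i) * star (zOp hq0 hq1 j) =
      (q : ℂ) • (star (zOp (n := n) hq0 hq1 j) * star (zOp hq0 hq1 i)) := by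
  have h1 := congrArg star (zOp_comm (n := n) hq0 hq1 h)
  rwa [star_mul, star_smul, star_mul, Complex.star_def, Complex.conj_ofReal] at h1

theorem zOp_cross_of_ne {i j : Fin (n + 1)} (h : i ≠ j) :
    star (zOp hq0 hq1 i) * zOp hq0 hq1 j =
      (q : ℂ) • (zOp (n := n) hq0 hq1 j * star (zOp hq0 hq1 i)) := by
  rcases lt_or_gt_of_ne h with h | h
  · exact zOp_cross hq0 hq1 h
  · have h1 := congrArg star (zOp_cross (n := n) hq0 hq1 h)
    rwa [star_mul, star_smul, star_mul, Complex.star_def, Complex.conj_ofReal, star_star] at h1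

theorem coweight_sq_last (k : Idx n) :
    coweight q (Fin.last n) k ^ 2 = q ^ (2 * psum (Fin.last n) k) := by
  simp [coweight, pow_mul, mul_comm 2]

theorem psum_succ (i : Fin n) (k : Idx n) : psum i.succ k = psum i.castSucc k + k.1 i := by
  have h : (Finset.univ.filter (fun l : Fin n => l.castSucc < i.succ)) =
      insert i (Finset.univ.filter (fun l : Fin n => l.castSucc < i.castSucc)) := by
    ext l
    simp [le_iff_eq_or_lt]
  rw [psum, h, Finset.sum_insert (by simp), psum, add_comm]

theorem coweight_sq_castSucc (hq0 : 0 ≤ q) (hq1 : q < 1) (i : Fin n) (k : Idx n) :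
    coweight q i.castSucc k ^ 2 =
      q ^ (2 * psum i.castSucc k) - q ^ (2 * psum i.succ k) := by
  have h : q ^ (2 * k.1 i) ≤ 1 := pow_le_one₀ hq0 hq1.le
  rw [coweight, Fin.lastCases_castSucc, mul_pow, Real.sq_sqrt (by linarith), psum_succ]
  ring

theorem weight_sq_castSucc (hq0 : 0 ≤ q) (hq1 : q < 1) (i : Fin n) (k : Idx n) :
    weight q i.castSucc k ^ 2 =
      coweight q i.castSucc k ^ 2 + (1 - q ^ 2) * q ^ (2 * psum i.succ k) := by
  have h : q ^ (2 * (k.1 i + 1)) ≤ 1 := pow_le_one₀ hq0 hq1.le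
  rw [coweight_sq_castSucc hq0 hq1, weight, Fin.lastCases_castSucc, mul_pow,
    Real.sq_sqrt (by linarith), psum_succ]
  ring

theorem sum_coweight_sq (hq0 : 0 ≤ q) (hq1 : q < 1) (i : Fin (n + 1)) (k : Idx n) :
    ∑ j ∈ Finset.Ici i, coweight q j k ^ 2 = q ^ (2 * psum i k) := by
  induction i using Fin.reverseInduction with
  | last =>
    have h : Finset.Ici (Fin.last n) = {Fin.last n} := by ext; simp [Fin.last_le_iff]
    rw [h, Finset.sum_singleton, coweight_sq_last]
  | cast i ih =>
    have h : Finset.Ici i.castSucc = insert i.castSucc (Finset.Ici i.succ) := by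
      ext j
      simp only [Finset.mem_Ici, Finset.mem_insert, ← Fin.castSucc_lt_iff_succ_le]
      rw [le_iff_eq_or_lt, eq_comm]
    rw [h, Finset.sum_insert (by simp), ih, coweight_sq_castSucc hq0 hq1]
    ring

theorem zOp_mul_star_ket (i : Fin (n + 1)) (k : Idx n) :
    (zOp hq0 hq1 i * star (zOp hq0 hq1 i)) (ket k) = ((coweight q i k ^ 2 : ℝ) : ℂ) • ket k := by
  rw [mul_op_apply, adjoint_zOp_ket, map_smul, zOp_ket, smul_smul]
  by_cases h : raise i (lower i k) = k
  · rw [← coweight_raise, h]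
    congr 1
    push_cast
    ring
  · simp [coweight_eq_zero h]

theorem star_mul_zOp_ket (i : Fin (n + 1)) (k : Idx n) :
    (star (zOp hq0 hq1 i) * zOp hq0 hq1 i) (ket k) = ((weight q i k ^ 2 : ℝ) : ℂ) • ket k := by
  rw [mul_op_apply, zOp_ket, map_smul, adjoint_zOp_ket, smul_smul, lower_raise, coweight_raise]
  congr 1
  push_cast
  ring

theorem sum_zOp_ket (s : Finset (Fin (n + 1))) (k : Idx n) :
    (∑ i ∈ s, zOp hq0 hq1 i * star (zOp hq0 hq1 i)) (ket k) =
      ((∑ i ∈ s, coweight q i k ^ 2 : ℝ) : ℂ) • ket k := by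
  rw [sum_apply, Complex.ofReal_sum, Finset.sum_smul]
  exact Finset.sum_congr rfl fun i _ => zOp_mul_star_ket hq0 hq1 i k

theorem zOp_diag (i : Fin (n + 1)) :
    star (zOp hq0 hq1 i) * zOp hq0 hq1 i = zOp (n := n) hq0 hq1 i * star (zOp hq0 hq1 i) +
      (1 - (q : ℂ) ^ 2) • ∑ j ∈ Finset.Ioi i, zOp hq0 hq1 j * star (zOp hq0 hq1 j) := by
  refine op_ext fun k => ?_
  change _ = (zOp hq0 hq1 i * star (zOp hq0 hq1 i)) (ket k) +
    (1 - (q : ℂ) ^ 2) • (∑ j ∈ Finset.Ioi i, zOp hq0 hq1 j * star (zOp hq0 hq1 j)) (ket k)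
  rw [zOp_mul_star_ket, star_mul_zOp_ket, sum_zOp_ket, smul_smul, ← add_smul]
  congr 1
  induction i using Fin.lastCases with
  | last =>
    have h : Finset.Ioi (Fin.last n) = ∅ := by ext; simp [Fin.le_last]
    simp [h, weight, coweight]
  | cast i =>
    have h : Finset.Ioi i.castSucc = Finset.Ici i.succ := by
      ext j
      simp only [Finset.mem_Ici, Finset.mem_Ioi, ← Fin.castSucc_lt_iff_succ_le]
    rw [h, sum_coweight_sq hq0 hq1, weight_sq_castSucc hq0 hq1]
    push_cast
    ring

theorem zOp_sphere : ∑ i, zOp (n := n) hq0 hq1 i * star (zOp hq0 hq1 i) = 1 := by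
  refine op_ext fun k => ?_
  have h : (Finset.univ : Finset (Fin (n + 1))) = Finset.Ici 0 := by ext; simp
  have h0 : psum 0 k = 0 := by simp [psum]
  rw [sum_zOp_ket, h, sum_coweight_sq hq0 hq1, h0]
  simp

/-- The representation `π` of the coordinate algebra on `ℓ²(ℕⁿ × ℤ)`. It is given on generators by
`π (z i) = zOp i`, see `sphereRep_z`, `zOp_ket_castSucc` and `zOp_ket_last`. -/
def sphereRep (n : ℕ) (q : ℝ) (hq0 : 0 ≤ q) (hq1 : q < 1) :
    CoordAlg n q →⋆ₐ[ℂ] (HSpace n →L[ℂ] HSpace n) where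
  __ := CoordAlg.liftAlg (zOp hq0 hq1) (fun i => star (zOp hq0 hq1 i))
    (fun _ _ h => zOp_comm hq0 hq1 h)
    (fun _ _ h => zOp_comm_star hq0 hq1 h) (fun _ _ h => zOp_cross_of_ne hq0 hq1 h)
    (zOp_diag hq0 hq1) (zOp_sphere hq0 hq1)
  map_star' a := by
    change CoordAlg.liftAlg _ _ _ _ _ _ _ (star a) = star (CoordAlg.liftAlg _ _ _ _ _ _ _ a)
    induction a using CoordAlg.induction with
    | halg c =>
      rw [CoordAlg.star_algebraMap, AlgHom.commutes, AlgHom.commutes, ← Complex.star_def,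
        algebraMap_star_comm]
    | hz i => rw [CoordAlg.star_z, CoordAlg.liftAlg_zs, CoordAlg.liftAlg_z]
    | hzs i => rw [CoordAlg.star_zs, CoordAlg.liftAlg_zs, CoordAlg.liftAlg_z, star_star]
    | hmul a b ha hb => rw [star_mul, map_mul, map_mul, star_mul, ha, hb]
    | hadd a b ha hb => rw [star_add, map_add, map_add, star_add, ha, hb]

theorem sphereRep_z (i : Fin (n + 1)) : sphereRep n q hq0 hq1 (CoordAlg.z i) = zOp hq0 hq1 i :=
  CoordAlg.liftAlg_z (fun _ _ h => zOp_comm hq0 hq1 h) (fun _ _ h => zOp_comm_star hq0 hq1 h)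
    (fun _ _ h => zOp_cross_of_ne hq0 hq1 h) (zOp_diag hq0 hq1) (zOp_sphere hq0 hq1) i

end Representation

end QSphere

/-! Existence and uniqueness of the extension are the universal property; the content is
injectivity. The torus `Torus n` acts on `CSphere n q` by `z i ↦ t i • z i`, and averaging `b` over
this action gives a map `E b = ∫ t, torusAct n q b t` that is faithful on positive elements. If `E`
can be shown to vanish on the kernel of `π`, then `π a = 0` gives `E (star a * a) = 0`, hence `a =
0` (`injective_of_comp_eq`).

Three facts make `E` vanish on the kernel. First, the kernel is torus-invariant: diagonal phase
operators on the Hilbert space implement the action (`phaseOp_mul_map`), so `π b = 0` forces `π (E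
b) = 0`. Second, `E` maps the coordinate algebra into the image of the algebra `diagSub` generated
by the commuting selfadjoint elements `x j = ∑ l ≥ j, z l * zs l`. Indeed every element is a
combination of products `d * monomial m` with `d` in `diagSub` (`monomialSpan_eq_top`), and the
average kills those with `m ≠ 0` (`integral_rotate_mem`). Third, among all *-homomorphisms to
C*-algebras, `sphereRep` gives the largest norm on `diagSub` (`norm_map_le_of_mem_diagSub`). Hence
`‖E b‖ ≤ ‖π (E b)‖` for `b` in a dense set, thus for all `b`.

The third fact is a computation of joint spectra. By Gelfand theory the norm of a polynomial in the
`x j` is controlled by its values at spectral points `v`. The identity `z i * p(x) * zs i = p(tw •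
x) * (x i - x (i+1))` shows that if `v i ≠ v (i+1)`, then multiplying the coordinates after `i` by
`q⁻²` gives another spectral point. Spectral points are bounded by 1, so this process must stop: `v
(i+1)` is zero or equals `q ^ (2 * k) * v i` for some natural `k`. As `x 0 = 1`, every spectral
point is a limit of points `(q ^ (2 * psum j k))_j`, and these are the joint eigenvalues of the `x
j` on the basis vectors `ket k`. -/

namespace QSphere

/-! ### Polynomial calculus in the free algebra, and commutation up to scalars -/

section Free

variable {ι A : Type*} [Ring A] [Algebra ℂ A]

/-- An intertwining relation on generators passes to all polynomials. Noncommutative polynomials are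
used throughout because they can be evaluated at scalars, operators and algebra elements alike, with
no commutativity to be checked. -/
theorem mul_lift_of_intertwine {x x' : ι → A} {y : A} (h : ∀ j, y * x j = x' j * y)
    (p : FreeAlgebra ℂ ι) : y * FreeAlgebra.lift ℂ x p = FreeAlgebra.lift ℂ x' p * y := by
  induction p using FreeAlgebra.induction with
  | grade0 c => simp only [AlgHom.commutes, Algebra.commutes]
  | grade1 j => simpa using h j
  | mul a b ha hb => rw [map_mul, map_mul, ← mul_assoc, ha, mul_assoc, hb, mul_assoc]
  | add a b ha hb => rw [map_add, map_add, mul_add, add_mul, ha, hb]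

/-- The endomorphism of the free algebra that scales the generators. -/
noncomputable def freeScale (c : ι → ℂ) : FreeAlgebra ℂ ι →ₐ[ℂ] FreeAlgebra ℂ ι :=
  FreeAlgebra.lift ℂ fun j => c j • FreeAlgebra.ι ℂ j

theorem lift_freeScale (c : ι → ℂ) (x : ι → A) (p : FreeAlgebra ℂ ι) :
    FreeAlgebra.lift ℂ x (freeScale c p) = FreeAlgebra.lift ℂ (fun j => c j • x j) p := by
  refine DFunLike.congr_fun (f := (FreeAlgebra.lift ℂ x).comp (freeScale c)) ?_ p
  ext j
  simp [freeScale]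

theorem map_freeLift {B : Type*} [Ring B] [Algebra ℂ B] (f : A →ₐ[ℂ] B) (x : ι → A)
    (p : FreeAlgebra ℂ ι) :
    f (FreeAlgebra.lift ℂ x p) = FreeAlgebra.lift ℂ (fun j => f (x j)) p := by
  refine DFunLike.congr_fun (f := f.comp (FreeAlgebra.lift ℂ x)) ?_ p
  ext j
  simp

/-- `a` and `b` commute up to a scalar. -/
def ScalarCommute (a b : A) : Prop := ∃ c : ℂ, a * b = c • (b * a)

theorem ScalarCommute.pow_right {a b : A} (h : ScalarCommute a b) (m : ℕ) :
    ScalarCommute a (b ^ m) := by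
  obtain ⟨c, hc⟩ := h
  refine ⟨c ^ m, ?_⟩
  induction m with
  | zero => simp
  | succ m ih =>
    rw [pow_succ, ← mul_assoc, ih, smul_mul_assoc, mul_assoc, hc, mul_smul_comm, smul_smul,
      pow_succ, mul_assoc]

/-- `y` can be moved to the right past the elements of the subalgebra `D`. -/
def MovesPast (D : Subalgebra ℂ A) (y : A) : Prop := ∀ d ∈ D, ∃ d' ∈ D, y * d = d' * y

theorem MovesPast.pow {D : Subalgebra ℂ A} {y : A} (h : MovesPast D y) (m : ℕ) :
    MovesPast D (y ^ m) := by
  induction m with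
  | zero => exact fun d hd => ⟨d, hd, by simp⟩
  | succ m ih =>
    intro d hd
    obtain ⟨d', hd', e⟩ := h d hd
    obtain ⟨d'', hd'', e'⟩ := ih d' hd'
    exact ⟨d'', hd'', by rw [pow_succ, mul_assoc, e, ← mul_assoc, e', mul_assoc]⟩

end Free

/-! ### The diagonal subalgebra and the spanning set of ordered monomials -/

namespace CoordAlg

variable {n : ℕ} {q : ℝ}

theorem scalarCommute_z_z (hq : q ≠ 0) {i j : Fin (n + 1)} (h : i ≠ j) :
    ScalarCommute (z i : CoordAlg n q) (z j) := by
  have hq' : (q : ℂ) ≠ 0 := by exact_mod_cast hq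
  rcases lt_or_gt_of_ne h with h | h
  · exact ⟨(q : ℂ)⁻¹, by rw [rel_comm h, smul_smul, inv_mul_cancel₀ hq', one_smul]⟩
  · exact ⟨q, rel_comm h⟩

theorem scalarCommute_zs_zs (hq : q ≠ 0) {i j : Fin (n + 1)} (h : i ≠ j) :
    ScalarCommute (zs i : CoordAlg n q) (zs j) := by
  have hq' : (q : ℂ) ≠ 0 := by exact_mod_cast hq
  rcases lt_or_gt_of_ne h with h | h
  · exact ⟨q, rel_comm_star h⟩
  · exact ⟨(q : ℂ)⁻¹, by rw [rel_comm_star h, smul_smul, inv_mul_cancel₀ hq', one_smul]⟩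

theorem scalarCommute_zs_z {i j : Fin (n + 1)} (h : i ≠ j) :
    ScalarCommute (zs i : CoordAlg n q) (z j) := ⟨q, rel_cross h⟩

theorem z_mul_zs (hq : q ≠ 0) {i j : Fin (n + 1)} (h : i ≠ j) :
    (z i * zs j : CoordAlg n q) = (q : ℂ)⁻¹ • (zs j * z i) := by
  have hq' : (q : ℂ) ≠ 0 := by exact_mod_cast hq
  rw [rel_cross h.symm, smul_smul, inv_mul_cancel₀ hq', one_smul]

theorem scalarCommute_z_zs (hq : q ≠ 0) {i j : Fin (n + 1)} (h : i ≠ j) :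
    ScalarCommute (z i : CoordAlg n q) (zs j) := ⟨_, z_mul_zs hq h⟩

/-- The element `∑ l ≥ j, z l * zs l`. -/
noncomputable def x (j : Fin (n + 1)) : CoordAlg n q := ∑ l ∈ Finset.Ici j, z l * zs l

theorem star_x (j : Fin (n + 1)) : star (x j : CoordAlg n q) = x j := by
  rw [x, star_sum]
  exact Finset.sum_congr rfl fun l _ => by rw [star_mul, star_z, star_zs]

theorem x_zero : (x 0 : CoordAlg n q) = 1 := by
  rw [x, ← rel_sphere]
  exact Finset.sum_congr (by ext; simp) fun _ _ => rfl

theorem x_eq_add_sum (i : Fin (n + 1)) :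
    (x i : CoordAlg n q) = z i * zs i + ∑ l ∈ Finset.Ioi i, z l * zs l := by
  have h : Finset.Ici i = insert i (Finset.Ioi i) := by
    ext j
    simp only [Finset.mem_Ici, Finset.mem_insert, Finset.mem_Ioi]
    rw [le_iff_eq_or_lt, eq_comm]
  rw [x, h, Finset.sum_insert (by simp)]

theorem sum_Ioi_castSucc (i : Fin n) :
    (∑ l ∈ Finset.Ioi i.castSucc, z l * zs l : CoordAlg n q) = x i.succ := by
  refine Finset.sum_congr ?_ fun _ _ => rfl
  ext j
  simp only [Finset.mem_Ici, Finset.mem_Ioi, ← Fin.castSucc_lt_iff_succ_le]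

theorem z_mul_zs_castSucc (i : Fin n) :
    (z i.castSucc * zs i.castSucc : CoordAlg n q) = x i.castSucc - x i.succ := by
  rw [x_eq_add_sum, sum_Ioi_castSucc, add_sub_cancel_right]

theorem z_mul_zs_last : (z (Fin.last n) * zs (Fin.last n) : CoordAlg n q) = x (Fin.last n) := by
  have h : Finset.Ioi (Fin.last n) = ∅ := by ext; simp [Fin.le_last]
  rw [x_eq_add_sum, h, Finset.sum_empty, add_zero]

/-- Passing `z l` and passing `zs l` each cost a factor `q⁻¹`. -/
theorem z_mul_of_lt (hq : q ≠ 0) {i l : Fin (n + 1)} (h : i < l) :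
    (z i * (z l * zs l) : CoordAlg n q) = ((q : ℂ) ^ 2)⁻¹ • (z l * zs l * z i) := by
  have hq' : (q : ℂ) ≠ 0 := by exact_mod_cast hq
  have h1 : (z i * z l : CoordAlg n q) = (q : ℂ)⁻¹ • (z l * z i) := by
    rw [rel_comm h, smul_smul, inv_mul_cancel₀ hq', one_smul]
  rw [← mul_assoc, h1, smul_mul_assoc, mul_assoc, z_mul_zs hq h.ne, mul_smul_comm, smul_smul,
    mul_assoc, sq, mul_inv]

/-- Here the factor `q` from passing `z l` cancels the factor `q⁻¹` from passing `zs l`. -/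
theorem z_mul_of_gt (hq : q ≠ 0) {i l : Fin (n + 1)} (h : l < i) :
    (z i * (z l * zs l) : CoordAlg n q) = z l * zs l * z i := by
  have hq' : (q : ℂ) ≠ 0 := by exact_mod_cast hq
  rw [← mul_assoc, rel_comm h, smul_mul_assoc, mul_assoc, z_mul_zs hq h.ne', mul_smul_comm,
    smul_smul, mul_inv_cancel₀ hq', one_smul, mul_assoc]

theorem z_mul_sum_Ioi (hq : q ≠ 0) (i : Fin (n + 1)) :
    (z i * ∑ l ∈ Finset.Ioi i, z l * zs l : CoordAlg n q) =
      ((q : ℂ) ^ 2)⁻¹ • ((∑ l ∈ Finset.Ioi i, z l * zs l) * z i) := by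
  rw [Finset.mul_sum, Finset.sum_mul, Finset.smul_sum]
  exact Finset.sum_congr rfl fun l hl => z_mul_of_lt hq (Finset.mem_Ioi.1 hl)

/-- The terms above `i` pick up `q ^ 2` when moved to the right of `z i`, and the correction `1 - q
^ 2` in the relation for `zs i * z i` supplies exactly the missing part. -/
theorem z_mul_x_self (hq : q ≠ 0) (i : Fin (n + 1)) :
    (z i * x i : CoordAlg n q) = x i * z i := by
  have hq' : (q : ℂ) ^ 2 ≠ 0 := by exact_mod_cast pow_ne_zero 2 hq
  have h : ((∑ l ∈ Finset.Ioi i, z l * zs l) * z i : CoordAlg n q) =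
      (q : ℂ) ^ 2 • (z i * ∑ l ∈ Finset.Ioi i, z l * zs l) := by
    rw [z_mul_sum_Ioi hq, smul_smul, mul_inv_cancel₀ hq', one_smul]
  rw [x_eq_add_sum, mul_add, add_mul, h, mul_assoc (z i) (zs i), rel_diag, mul_add,
    mul_smul_comm, sub_smul, one_smul]
  abel

/-- The scalar `tw q i j` such that `z i * x j = tw q i j • (x j * z i)`. -/
noncomputable def tw (q : ℝ) (i j : Fin (n + 1)) : ℂ := if i < j then ((q : ℂ) ^ 2)⁻¹ else 1

theorem tw_ne_zero (hq : q ≠ 0) (i j : Fin (n + 1)) : tw q i j ≠ 0 := by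
  have hq' : (q : ℂ) ^ 2 ≠ 0 := by exact_mod_cast pow_ne_zero 2 hq
  rw [tw]
  split_ifs
  · exact inv_ne_zero hq'
  · exact one_ne_zero

theorem conj_tw (i j : Fin (n + 1)) : conj (tw q i j) = tw q i j := by
  rw [tw]; split_ifs <;> simp

/-- If `i < j`, all summands of `x j` scale alike. If `j ≤ i`, the summands below `i` commute with
`z i` one by one, but the remaining ones only as the whole sum `x i`. -/
theorem z_mul_x (hq : q ≠ 0) (i j : Fin (n + 1)) :
    (z i * x j : CoordAlg n q) = (tw q i j • x j) * z i := by
  rw [tw]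
  split_ifs with h
  · rw [x, Finset.mul_sum, smul_mul_assoc, Finset.sum_mul, Finset.smul_sum]
    exact Finset.sum_congr rfl fun l hl => z_mul_of_lt hq (h.trans_le (Finset.mem_Ici.1 hl))
  · have hji : j ≤ i := not_lt.1 h
    have hs : Finset.Ici j = Finset.Ico j i ∪ Finset.Ici i := by
      ext l
      simp only [Finset.mem_Ici, Finset.mem_union, Finset.mem_Ico]
      constructor
      · intro hl
        rcases lt_or_ge l i with h | h
        · exact Or.inl ⟨hl, h⟩
        · exact Or.inr h
      · rintro (⟨h, -⟩ | h)
        · exact h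
        · exact hji.trans h
    have hd : Disjoint (Finset.Ico j i) (Finset.Ici i) :=
      Finset.disjoint_left.2 fun l hl hl' =>
        absurd (Finset.mem_Ici.1 hl') (not_le.2 (Finset.mem_Ico.1 hl).2)
    have hx : (x j : CoordAlg n q) = ∑ l ∈ Finset.Ico j i, z l * zs l + x i := by
      rw [x, hs, Finset.sum_union hd, x]
    rw [one_smul, hx, mul_add, add_mul, z_mul_x_self hq, Finset.mul_sum, Finset.sum_mul]
    congr 1
    exact Finset.sum_congr rfl fun l hl => z_mul_of_gt hq (Finset.mem_Ico.1 hl).2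

theorem zs_mul_x (hq : q ≠ 0) (i j : Fin (n + 1)) :
    (zs i * x j : CoordAlg n q) = ((tw q i j)⁻¹ • x j) * zs i := by
  have h := congrArg star (z_mul_x hq i j)
  rw [star_mul, star_mul, star_smul, star_x, star_z, Complex.star_def, conj_tw] at h
  rw [smul_mul_assoc, h, mul_smul_comm, smul_smul, inv_mul_cancel₀ (tw_ne_zero hq i j), one_smul]

/-- The subalgebra generated by the elements `x j`. -/
noncomputable def diagSub (n : ℕ) (q : ℝ) : Subalgebra ℂ (CoordAlg n q) :=
  (FreeAlgebra.lift ℂ (x : Fin (n + 1) → CoordAlg n q)).range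

/-- Rescaling the `x j` is absorbed into the polynomial; this keeps `diagSub` stable when a
generator is moved past it. -/
theorem lift_smul_x_mem (c : Fin (n + 1) → ℂ) (p : FreeAlgebra ℂ (Fin (n + 1))) :
    FreeAlgebra.lift ℂ (fun j => c j • (x j : CoordAlg n q)) p ∈ diagSub n q :=
  ⟨freeScale c p, lift_freeScale c x p⟩

theorem x_mem (j : Fin (n + 1)) : (x j : CoordAlg n q) ∈ diagSub n q :=
  ⟨FreeAlgebra.ι ℂ j, FreeAlgebra.lift_ι_apply _ _⟩

theorem z_mul_zs_mem (i : Fin (n + 1)) : (z i * zs i : CoordAlg n q) ∈ diagSub n q := by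
  induction i using Fin.lastCases with
  | last => rw [z_mul_zs_last]; exact x_mem _
  | cast i => rw [z_mul_zs_castSucc]; exact sub_mem (x_mem _) (x_mem _)

theorem zs_mul_z_mem (i : Fin (n + 1)) : (zs i * z i : CoordAlg n q) ∈ diagSub n q := by
  rw [rel_diag]
  exact add_mem (z_mul_zs_mem i) (Subalgebra.smul_mem _ (sum_mem fun j _ => z_mul_zs_mem j) _)

theorem movesPast_z (hq : q ≠ 0) (i : Fin (n + 1)) : MovesPast (diagSub n q) (z i) := by
  rintro _ ⟨p, rfl⟩
  exact ⟨_, lift_smul_x_mem _ p, mul_lift_of_intertwine (z_mul_x hq i) p⟩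

theorem movesPast_zs (hq : q ≠ 0) (i : Fin (n + 1)) : MovesPast (diagSub n q) (zs i) := by
  rintro _ ⟨p, rfl⟩
  exact ⟨_, lift_smul_x_mem _ p, mul_lift_of_intertwine (zs_mul_x hq i) p⟩

/-- The power `z i ^ m` for `m ≥ 0`, and `zs i ^ (-m)` for `m < 0`. -/
noncomputable def zpow (i : Fin (n + 1)) : ℤ → CoordAlg n q
  | .ofNat m => z i ^ m
  | .negSucc m => zs i ^ (m + 1)

theorem zpow_cases {P : CoordAlg n q → Prop} (i : Fin (n + 1)) (hz : ∀ m, P (z i ^ m))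
    (hzs : ∀ m, P (zs i ^ m)) (m : ℤ) : P (zpow i m) := by
  cases m with
  | ofNat m => exact hz m
  | negSucc m => exact hzs (m + 1)

theorem movesPast_zpow (hq : q ≠ 0) (i : Fin (n + 1)) (m : ℤ) :
    MovesPast (diagSub n q) (zpow i m) :=
  zpow_cases i (movesPast_z hq i).pow (movesPast_zs hq i).pow m

/-- For negative exponents the new `z i` meets a `zs i`, and their product is split off as the
diagonal factor. -/
theorem z_mul_zpow_self (i : Fin (n + 1)) (m : ℤ) :
    ∃ d ∈ diagSub n q, z i * zpow i m = d * zpow i (m + 1) := by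
  match m with
  | .ofNat m => exact ⟨1, one_mem _, by rw [one_mul]; exact (pow_succ' _ _).symm⟩
  | .negSucc 0 => exact ⟨z i * zs i, z_mul_zs_mem i, by simp [zpow]⟩
  | .negSucc (m + 1) =>
    refine ⟨z i * zs i, z_mul_zs_mem i, ?_⟩
    change z i * zs i ^ (m + 1 + 1) = z i * zs i * zs i ^ (m + 1)
    rw [pow_succ', mul_assoc]

theorem zs_mul_zpow_self (i : Fin (n + 1)) (m : ℤ) :
    ∃ d ∈ diagSub n q, zs i * zpow i m = d * zpow i (m - 1) := by
  match m with
  | .ofNat 0 =>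
    refine ⟨1, one_mem _, ?_⟩
    change zs i * z i ^ 0 = 1 * zs i ^ (0 + 1)
    simp
  | .ofNat (m + 1) =>
    refine ⟨zs i * z i, zs_mul_z_mem i, ?_⟩
    have h : Int.ofNat (m + 1) - 1 = Int.ofNat m := by simp
    rw [h]
    change zs i * z i ^ (m + 1) = zs i * z i * z i ^ m
    rw [pow_succ', mul_assoc]
  | .negSucc m => exact ⟨1, one_mem _, by rw [one_mul]; exact (pow_succ' _ _).symm⟩

/-- The ordered product of the powers `zpow i (m i)` with `i` in the list `l`. -/
noncomputable def monomial (m : Fin (n + 1) → ℤ) (l : List (Fin (n + 1))) : CoordAlg n q :=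
  (l.map fun i => zpow i (m i)).prod

theorem monomial_cons (m : Fin (n + 1) → ℤ) (i : Fin (n + 1)) (l : List (Fin (n + 1))) :
    (monomial m (i :: l) : CoordAlg n q) = zpow i (m i) * monomial m l := by
  simp [monomial]

theorem monomial_update {m : Fin (n + 1) → ℤ} {i : Fin (n + 1)} {l : List (Fin (n + 1))}
    (h : i ∉ l) (e : ℤ) : (monomial (Function.update m i e) l : CoordAlg n q) = monomial m l := by
  refine congrArg List.prod (List.map_congr_left fun j hj => ?_)
  rw [Function.update_of_ne (by rintro rfl; exact h hj)]

/-- The factor `y` travels right, collecting scalars, until it reaches the power with index `i`. The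
diagonal element produced there then travels back to the left through the powers already passed. -/
theorem mul_monomial (hq : q ≠ 0) {y : CoordAlg n q} {i : Fin (n + 1)} {e : ℤ}
    (hself : ∀ m, ∃ d ∈ diagSub n q, y * zpow i m = d * zpow i (m + e))
    (hne : ∀ j ≠ i, ∀ m, ScalarCommute y (zpow j m)) (m : Fin (n + 1) → ℤ)
    (l : List (Fin (n + 1))) (hl : l.Nodup) (hi : i ∈ l) :
    ∃ d ∈ diagSub n q, y * monomial m l = d * monomial (Function.update m i (m i + e)) l := by
  induction l with
  | nil => simp at hi
  | cons j l ih =>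
    rw [List.nodup_cons] at hl
    by_cases hj : j = i
    · subst hj
      obtain ⟨d, hd, h⟩ := hself (m j)
      refine ⟨d, hd, ?_⟩
      rw [monomial_cons, monomial_cons, monomial_update hl.1, Function.update_self, ← mul_assoc, h,
        mul_assoc]
    · obtain ⟨d, hd, h⟩ := ih hl.2 ((List.mem_cons.1 hi).resolve_left (Ne.symm hj))
      obtain ⟨c, hc⟩ := hne j hj (m j)
      obtain ⟨d', hd', h'⟩ := movesPast_zpow hq j (m j) d hd
      refine ⟨c • d', Subalgebra.smul_mem _ hd' c, ?_⟩
      rw [monomial_cons, monomial_cons, Function.update_of_ne hj, ← mul_assoc, hc, smul_mul_assoc,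
        mul_assoc, h, ← mul_assoc, h', smul_mul_assoc, mul_assoc]

/-- The span of the products of an element of `diagSub` and an ordered monomial. -/
noncomputable def monomialSpan (n : ℕ) (q : ℝ) : Submodule ℂ (CoordAlg n q) :=
  Submodule.span ℂ {a | ∃ d ∈ diagSub n q, ∃ m, a = d * monomial m (List.finRange (n + 1))}

theorem mul_mem_monomialSpan {y : CoordAlg n q} (hy : MovesPast (diagSub n q) y)
    (h : ∀ m, ∃ d ∈ diagSub n q, ∃ m', y * monomial m (List.finRange (n + 1)) =
      d * monomial m' (List.finRange (n + 1))) {a : CoordAlg n q} (ha : a ∈ monomialSpan n q) :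
    y * a ∈ monomialSpan n q := by
  induction ha using Submodule.span_induction with
  | mem a ha =>
    obtain ⟨d, hd, m, rfl⟩ := ha
    obtain ⟨d', hd', h'⟩ := hy d hd
    obtain ⟨d'', hd'', m', h''⟩ := h m
    refine Submodule.subset_span ⟨d' * d'', mul_mem hd' hd'', m', ?_⟩
    rw [← mul_assoc, h', mul_assoc, h'', mul_assoc]
  | zero => rw [mul_zero]; exact zero_mem _
  | add a b _ _ ha hb => rw [mul_add]; exact add_mem ha hb
  | smul c a _ ha => rw [mul_smul_comm]; exact Submodule.smul_mem _ _ ha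

theorem z_mul_mem_monomialSpan (hq : q ≠ 0) (i : Fin (n + 1)) {a : CoordAlg n q}
    (ha : a ∈ monomialSpan n q) : z i * a ∈ monomialSpan n q := by
  refine mul_mem_monomialSpan (movesPast_z hq i) (fun m => ?_) ha
  obtain ⟨d, hd, h⟩ := mul_monomial hq (z_mul_zpow_self i)
    (fun j hj => zpow_cases j (scalarCommute_z_z hq hj.symm).pow_right
      (scalarCommute_z_zs hq hj.symm).pow_right) m _ (List.nodup_finRange _) (List.mem_finRange i)
  exact ⟨d, hd, _, h⟩

theorem zs_mul_mem_monomialSpan (hq : q ≠ 0) (i : Fin (n + 1)) {a : CoordAlg n q}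
    (ha : a ∈ monomialSpan n q) : zs i * a ∈ monomialSpan n q := by
  refine mul_mem_monomialSpan (movesPast_zs hq i) (fun m => ?_) ha
  obtain ⟨d, hd, h⟩ := mul_monomial hq (zs_mul_zpow_self i)
    (fun j hj => zpow_cases j (scalarCommute_zs_z hj.symm).pow_right
      (scalarCommute_zs_zs hq hj.symm).pow_right) m _ (List.nodup_finRange _) (List.mem_finRange i)
  exact ⟨d, hd, _, h⟩

theorem monomial_zero (l : List (Fin (n + 1))) : (monomial 0 l : CoordAlg n q) = 1 := by
  refine List.prod_eq_one fun a ha => ?_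
  obtain ⟨i, -, rfl⟩ := List.mem_map.1 ha
  exact pow_zero _

theorem monomialSpan_eq_top (hq : q ≠ 0) : monomialSpan n q = ⊤ := by
  refine eq_top_iff.2 fun a _ => ?_
  -- The span contains `1`, so it suffices that it is a left ideal; quantifying over `b` lets the
  -- induction handle products.
  suffices h : ∀ a b : CoordAlg n q, b ∈ monomialSpan n q → a * b ∈ monomialSpan n q by
    have h1 : (1 : CoordAlg n q) ∈ monomialSpan n q :=
      Submodule.subset_span ⟨1, one_mem _, 0, by rw [monomial_zero, one_mul]⟩
    simpa using h a 1 h1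
  intro a
  induction a using CoordAlg.induction with
  | halg c => intro b hb; rw [← Algebra.smul_def]; exact Submodule.smul_mem _ _ hb
  | hz i => exact fun b => z_mul_mem_monomialSpan hq i
  | hzs i => exact fun b => zs_mul_mem_monomialSpan hq i
  | hmul a b ha hb => intro c hc; rw [mul_assoc]; exact ha _ (hb _ hc)
  | hadd a b ha hb => intro c hc; rw [add_mul]; exact add_mem (ha _ hc) (hb _ hc)

end CoordAlg

end QSphere

namespace QSphere

/-! ### Spectral points and norms of polynomials in commuting elements -/

section JointSpectrum

open Filter Topology

variable {ι B : Type*}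

/-- A point `v` is a spectral point of the family `x` if evaluation at `v` of
noncommutative polynomials is bounded by a multiple of the norm of their values at `x`. -/
def IsSpectralPoint [NormedRing B] [Algebra ℂ B] (x : ι → B) (v : ι → ℂ) : Prop :=
  ∃ C : ℝ, ∀ p : FreeAlgebra ℂ ι, ‖FreeAlgebra.lift ℂ v p‖ ≤ C * ‖FreeAlgebra.lift ℂ x p‖

/-- Testing on the powers of one variable removes the constant: `‖v j‖ ^ N` stays bounded in `N`. -/
theorem IsSpectralPoint.norm_le_one [NormedRing B] [NormOneClass B] [Algebra ℂ B] {x : ι → B}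
    {v : ι → ℂ} (h : IsSpectralPoint x v) {j : ι} (hj : ‖x j‖ ≤ 1) : ‖v j‖ ≤ 1 := by
  obtain ⟨C, hC⟩ := h
  by_contra hv
  obtain ⟨N, hN⟩ := pow_unbounded_of_one_lt |C| (not_le.1 hv)
  have h1 := hC (FreeAlgebra.ι ℂ j ^ N)
  rw [map_pow, map_pow, FreeAlgebra.lift_ι_apply, FreeAlgebra.lift_ι_apply, norm_pow] at h1
  have h2 : ‖x j ^ N‖ ≤ 1 := (norm_pow_le _ _).trans (pow_le_one₀ (norm_nonneg _) hj)
  have h3 : C * ‖x j ^ N‖ ≤ |C| * 1 :=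
    mul_le_mul (le_abs_self C) h2 (norm_nonneg _) (abs_nonneg _)
  linarith

theorem IsSpectralPoint.eq_one [NormedRing B] [Algebra ℂ B] {x : ι → B}
    {v : ι → ℂ} (h : IsSpectralPoint x v) {j : ι} (hj : x j = 1) : v j = 1 := by
  obtain ⟨C, hC⟩ := h
  have h1 := hC (FreeAlgebra.ι ℂ j - 1)
  rw [map_sub, map_sub, map_one, map_one, FreeAlgebra.lift_ι_apply, FreeAlgebra.lift_ι_apply, hj,
    sub_self, norm_zero, mul_zero] at h1
  exact sub_eq_zero.1 (norm_le_zero_iff.1 h1)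

theorem continuous_freeLift (p : FreeAlgebra ℂ ι) :
    Continuous fun v : ι → ℂ => FreeAlgebra.lift ℂ v p := by
  induction p using FreeAlgebra.induction with
  | grade0 c => simp only [AlgHom.commutes]; exact continuous_const
  | grade1 j => simpa using continuous_apply j
  | mul a b ha hb => simp only [map_mul]; exact ha.mul hb
  | add a b ha hb => simp only [map_add]; exact ha.add hb

/-- The norm of a polynomial in commuting selfadjoint elements of a C*-algebra is at most the
supremum of its absolute values at the spectral points. -/
theorem norm_freeLift_le [CStarAlgebra B] {x : ι → B} (hs : ∀ j, star (x j) = x j)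
    (hc : ∀ i j, x i * x j = x j * x i) {p : FreeAlgebra ℂ ι} {M : ℝ} (hM : 0 ≤ M)
    (h : ∀ v, IsSpectralPoint x v → ‖FreeAlgebra.lift ℂ v p‖ ≤ M) :
    ‖FreeAlgebra.lift ℂ x p‖ ≤ M := by
  let s : StarSubalgebra ℂ B := StarAlgebra.adjoin ℂ (Set.range x)
  have hcomm : IsMulCommutative s := StarAlgebra.isMulCommutative_adjoin ℂ
    (by rintro _ ⟨i, rfl⟩ _ ⟨j, rfl⟩; exact hc i j)
    (by rintro _ ⟨i, rfl⟩ _ ⟨j, rfl⟩; rw [hs]; exact hc i j)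
  -- The commutative C*-algebra generated by the `x j`; on it the Gelfand transform is isometric,
  -- and each character yields a spectral point with constant `1`.
  let S : StarSubalgebra ℂ B := s.topologicalClosure
  have hcl : IsClosed (S : Set B) := s.isClosed_topologicalClosure
  let _ : CStarAlgebra S := StarSubalgebra.cstarAlgebra S
  have hScomm : ∀ a b : S, a * b = b * a :=
    (s.commRingTopologicalClosure fun a b => hcomm.is_comm.comm a b).mul_comm
  let _ : CommCStarAlgebra S := { (inferInstance : CStarAlgebra S) with mul_comm := hScomm }
  let y : ι → S := fun j =>
    ⟨x j, s.le_topologicalClosure (StarAlgebra.subset_adjoin ℂ _ ⟨j, rfl⟩)⟩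
  have hy : ∀ r, (FreeAlgebra.lift ℂ y r : B) = FreeAlgebra.lift ℂ x r := fun r =>
    map_freeLift S.toSubalgebra.val y r
  have h1 : ‖WeakDual.gelfandTransform ℂ S (FreeAlgebra.lift ℂ y p)‖ ≤ M := by
    refine (ContinuousMap.norm_le _ hM).2 fun φ => ?_
    have h2 : ∀ r, φ (FreeAlgebra.lift ℂ y r) = FreeAlgebra.lift ℂ (fun j => φ (y j)) r :=
      fun r => map_freeLift (WeakDual.CharacterSpace.toAlgHom φ) y r
    change ‖φ (FreeAlgebra.lift ℂ y p)‖ ≤ M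
    rw [h2]
    refine h _ ?_
    by_cases hn : Nontrivial S
    · refine ⟨1, fun r => ?_⟩
      rw [← h2, ← hy, one_mul]
      exact AlgHom.norm_apply_le_self φ _
    -- A zero algebra has no characters, since `φ 1 = 1` and `φ 0 = 0`.
    · rw [not_nontrivial_iff_subsingleton] at hn
      have h3 : φ 1 = φ 0 := congrArg φ (Subsingleton.elim _ _)
      rw [map_one, map_zero] at h3
      exact absurd h3 one_ne_zero
  rw [← hy]
  refine le_trans (le_of_eq ?_) h1
  exact ((gelfandTransform_isometry S).norm_map_of_map_zero (map_zero _) _).symm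

end JointSpectrum

/-! ### The joint spectrum of the elements `x j` -/

section DiagonalNorm

open Filter Topology

variable {n : ℕ} {q : ℝ}

theorem CoordAlg.x_comm (hq : q ≠ 0) (i j : Fin (n + 1)) :
    (CoordAlg.x i * CoordAlg.x j : CoordAlg n q) = CoordAlg.x j * CoordAlg.x i := by
  have h : ∀ l, (CoordAlg.z l * CoordAlg.zs l * CoordAlg.x j : CoordAlg n q) =
      CoordAlg.x j * (CoordAlg.z l * CoordAlg.zs l) := fun l => by
    rw [mul_assoc, CoordAlg.zs_mul_x hq, ← mul_assoc, mul_smul_comm, CoordAlg.z_mul_x hq,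
      smul_mul_assoc, smul_mul_assoc, smul_mul_assoc, smul_smul,
      inv_mul_cancel₀ (CoordAlg.tw_ne_zero hq _ _), one_smul, mul_assoc]
  rw [CoordAlg.x, Finset.sum_mul, Finset.mul_sum]
  exact Finset.sum_congr rfl fun l _ => h l

variable {B : Type*} [CStarAlgebra B]

/-- The image of `x j` is a partial sum of positive elements whose total is `1`. -/
theorem norm_map_x_le [Nontrivial B] (f : CoordAlg n q →⋆ₐ[ℂ] B) (j : Fin (n + 1)) :
    ‖f (CoordAlg.x j)‖ ≤ 1 := by
  let _ := CStarAlgebra.spectralOrder B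
  have _ := CStarAlgebra.spectralOrderedRing B
  have h : ∀ l, f (CoordAlg.z l * CoordAlg.zs l) = f (CoordAlg.z l) * star (f (CoordAlg.z l)) :=
    fun l => by rw [map_mul, ← CoordAlg.star_z, map_star]
  have h0 : f (CoordAlg.x j) = ∑ l ∈ Finset.Ici j, f (CoordAlg.z l) * star (f (CoordAlg.z l)) := by
    rw [CoordAlg.x, map_sum]
    exact Finset.sum_congr rfl fun l _ => h l
  have h1 : ∑ l, f (CoordAlg.z l) * star (f (CoordAlg.z l)) = 1 := by
    rw [← map_one f, ← CoordAlg.rel_sphere, map_sum]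
    exact Finset.sum_congr rfl fun l _ => (h l).symm
  have hnn : 0 ≤ f (CoordAlg.x j) := by
    rw [h0]; exact Finset.sum_nonneg fun l _ => mul_star_self_nonneg _
  refine (CStarAlgebra.norm_le_one_iff_of_nonneg _ hnn).2 ?_
  rw [h0, ← h1]
  exact Finset.sum_le_univ_sum_of_nonneg fun l => mul_star_self_nonneg _

/-- Compressing by `z i` twists polynomials: `z i * p(x) * zs i = p(tw • x) * (x i - x (i+1))`.
Evaluating the right side at `v` gives `p(tw • v)` times a nonzero number, while the norm of the
left side is at most a multiple of `‖p(x)‖`. -/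
theorem isSpectralPoint_tw (hq : q ≠ 0) (f : CoordAlg n q →⋆ₐ[ℂ] B) {v : Fin (n + 1) → ℂ}
    (h : IsSpectralPoint (fun j => f (CoordAlg.x j)) v) {i : Fin n}
    (hi : v i.castSucc ≠ v i.succ) :
    IsSpectralPoint (fun j => f (CoordAlg.x j)) fun j => CoordAlg.tw q i.castSucc j * v j := by
  obtain ⟨C, hC⟩ := h
  have hne : 0 < ‖v i.castSucc - v i.succ‖ := norm_pos_iff.2 (sub_ne_zero.2 hi)
  refine ⟨‖v i.castSucc - v i.succ‖⁻¹ *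
    (|C| * (‖f (CoordAlg.z i.castSucc)‖ * ‖f (CoordAlg.zs i.castSucc)‖)), fun p => ?_⟩
  -- The test polynomial is `p(tw • X) * (X i - X (i+1))`, the right side of the compression
  -- identity.
  have h1 := hC (freeScale (CoordAlg.tw q i.castSucc) p *
    (FreeAlgebra.ι ℂ i.castSucc - FreeAlgebra.ι ℂ i.succ))
  rw [map_mul, map_mul, lift_freeScale, lift_freeScale, map_sub, map_sub,
    FreeAlgebra.lift_ι_apply, FreeAlgebra.lift_ι_apply, FreeAlgebra.lift_ι_apply,
    FreeAlgebra.lift_ι_apply, ← map_sub, ← CoordAlg.z_mul_zs_castSucc, map_mul, ← mul_assoc,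
    ← mul_lift_of_intertwine (x := fun j => f (CoordAlg.x j)) (y := f (CoordAlg.z i.castSucc))
      (fun j => by rw [← map_mul, CoordAlg.z_mul_x hq, map_mul, map_smul]), norm_mul] at h1
  have h2 : ‖f (CoordAlg.z i.castSucc) * (FreeAlgebra.lift ℂ (fun j => f (CoordAlg.x j)) p *
      f (CoordAlg.zs i.castSucc))‖ ≤ ‖f (CoordAlg.z i.castSucc)‖ *
        (‖FreeAlgebra.lift ℂ (fun j => f (CoordAlg.x j)) p‖ * ‖f (CoordAlg.zs i.castSucc)‖) :=
    (norm_mul_le _ _).trans (mul_le_mul_of_nonneg_left (norm_mul_le _ _) (norm_nonneg _))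
  have h3 := h1.trans (mul_le_mul (le_abs_self C)
    (by simpa only [mul_assoc] using h2) (norm_nonneg _) (abs_nonneg C))
  rw [mul_assoc, inv_mul_eq_div, le_div_iff₀ hne]
  refine h3.trans (le_of_eq ?_)
  ring

theorem sphereRep_x_ket (hq0 : 0 ≤ q) (hq1 : q < 1) (j : Fin (n + 1)) (k : Idx n) :
    sphereRep n q hq0 hq1 (CoordAlg.x j) (ket k) = ((q ^ (2 * psum j k) : ℝ) : ℂ) • ket k := by
  rw [← sum_coweight_sq hq0 hq1, ← sum_zOp_ket hq0 hq1, CoordAlg.x, map_sum]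
  congr 1
  refine Finset.sum_congr rfl fun l _ => ?_
  rw [map_mul, ← CoordAlg.star_z, map_star, sphereRep_z]

theorem freeLift_apply_of_eigenvector {V : Type*} [NormedAddCommGroup V] [NormedSpace ℂ V]
    {ι : Type*} {T : ι → V →L[ℂ] V} {v : ι → ℂ} {e : V} (h : ∀ j, T j e = v j • e)
    (p : FreeAlgebra ℂ ι) : FreeAlgebra.lift ℂ T p e = FreeAlgebra.lift ℂ v p • e := by
  induction p using FreeAlgebra.induction with
  | grade0 c => simp [Algebra.algebraMap_eq_smul_one]
  | grade1 j => simpa using h j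
  | mul a b ha hb =>
    rw [map_mul, map_mul, mul_apply_eq_comp, hb, map_smul, ha, smul_smul, mul_comm]
  | add a b ha hb => rw [map_add, map_add, add_apply, ha, hb, add_smul]

/-- The scalar on the left is the eigenvalue of the operator on the unit vector `ket k`. -/
theorem norm_freeLift_psum_le (hq0 : 0 ≤ q) (hq1 : q < 1) (k : Idx n)
    (p : FreeAlgebra ℂ (Fin (n + 1))) :
    ‖FreeAlgebra.lift ℂ (fun j => ((q ^ (2 * psum j k) : ℝ) : ℂ)) p‖ ≤
      ‖sphereRep n q hq0 hq1 (FreeAlgebra.lift ℂ CoordAlg.x p)‖ := by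
  have h := freeLift_apply_of_eigenvector (fun j => sphereRep_x_ket hq0 hq1 j k) p
  have h1 := map_freeLift (sphereRep n q hq0 hq1).toAlgHom CoordAlg.x p
  have h2 := (sphereRep n q hq0 hq1 (FreeAlgebra.lift ℂ CoordAlg.x p)).le_opNorm (ket k)
  have hk : ‖(ket k : HSpace n)‖ = 1 := orthonormal_ket.1 k
  change sphereRep n q hq0 hq1 _ = FreeAlgebra.lift ℂ (fun j => sphereRep n q hq0 hq1 _) p at h1
  rwa [hk, mul_one, h1, h, norm_smul, hk, mul_one, ← h1] at h2

/-- Otherwise the twist at `i` could be iterated forever: it fixes `v i` and multiplies `v (i+1)` by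
`q⁻²`, so the two coordinates never meet. A nonzero `v (i+1)` would then exceed the bound `1`. -/
theorem IsSpectralPoint.succ_eq [Nontrivial B] (hq0 : 0 < q) (hq1 : q < 1)
    (f : CoordAlg n q →⋆ₐ[ℂ] B) {v : Fin (n + 1) → ℂ}
    (h : IsSpectralPoint (fun j => f (CoordAlg.x j)) v) (i : Fin n) :
    v i.succ = 0 ∨ ∃ k : ℕ, v i.succ = (q : ℂ) ^ (2 * k) * v i.castSucc := by
  by_contra! hcon
  obtain ⟨h0, hne⟩ := hcon
  have hqc : (q : ℂ) ≠ 0 := by exact_mod_cast hq0.ne'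
  have hk : ∀ k : ℕ, IsSpectralPoint (fun j => f (CoordAlg.x j))
      fun j => CoordAlg.tw q i.castSucc j ^ k * v j := by
    intro k
    induction k with
    | zero => simpa using h
    | succ k ih =>
      have := isSpectralPoint_tw hq0.ne' f ih (i := i) (by
        intro he
        apply hne k
        simp only [CoordAlg.tw, lt_irrefl, if_false, one_pow, one_mul, Fin.castSucc_lt_succ,
          if_true] at he
        rw [he, pow_mul, ← mul_assoc, ← mul_pow, mul_inv_cancel₀ (pow_ne_zero 2 hqc), one_pow,
          one_mul])
      simpa only [pow_succ', mul_assoc] using this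
  have hq2 : 1 < (q ^ 2)⁻¹ := (one_lt_inv₀ (by positivity)).2 (by nlinarith)
  obtain ⟨N, hN⟩ := pow_unbounded_of_one_lt ‖v i.succ‖⁻¹ hq2
  have h1 := (hk N).norm_le_one (j := i.succ) (norm_map_x_le f _)
  simp only [CoordAlg.tw, Fin.castSucc_lt_succ, if_true, norm_mul, norm_pow, norm_inv,
    Complex.norm_real, Real.norm_of_nonneg hq0.le] at h1
  have h2 := mul_lt_mul_of_pos_right hN (norm_pos_iff.2 h0)
  rw [inv_mul_cancel₀ (norm_ne_zero_iff.2 h0)] at h2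
  linarith

theorem IsSpectralPoint.exists_tendsto [Nontrivial B] (hq0 : 0 < q) (hq1 : q < 1)
    (f : CoordAlg n q →⋆ₐ[ℂ] B) {v : Fin (n + 1) → ℂ}
    (h : IsSpectralPoint (fun j => f (CoordAlg.x j)) v) :
    ∃ k : ℕ → Idx n, Tendsto (fun N j => ((q ^ (2 * psum j (k N)) : ℝ) : ℂ)) atTop (𝓝 v) := by
  have hc : ∀ i : Fin n, ∃ k : ℕ → ℕ, ∃ c : ℂ, v i.succ = v i.castSucc * c ∧
      Tendsto (fun N => ((q ^ (2 * k N) : ℝ) : ℂ)) atTop (𝓝 c) := by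
    intro i
    rcases h.succ_eq hq0 hq1 f i with h0 | ⟨k, hk⟩
    -- A vanishing coordinate is not an eigenvalue but is the limit of `q ^ (2 * N)`, so the label
    -- runs to infinity.
    · refine ⟨id, 0, by rw [h0, mul_zero], ?_⟩
      have h2 : Tendsto (fun N : ℕ => (q ^ 2) ^ N) atTop (𝓝 0) :=
        tendsto_pow_atTop_nhds_zero_of_lt_one (by positivity) (by nlinarith)
      have h3 := (Complex.continuous_ofReal.tendsto 0).comp h2
      rw [Complex.ofReal_zero] at h3
      exact h3.congr fun N => by rw [pow_mul]; rfl
    · exact ⟨fun _ => k, (q : ℂ) ^ (2 * k), by rw [hk, mul_comm],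
        by push_cast; exact tendsto_const_nhds⟩
  choose k c hv hk using hc
  -- The integer label does not enter `psum`, so `0` serves.
  refine ⟨fun N => (fun i => k i N, 0), tendsto_pi_nhds.2 fun j => ?_⟩
  induction j using Fin.induction with
  | zero =>
    have h0 : v 0 = 1 := h.eq_one (by rw [CoordAlg.x_zero, map_one])
    simp [psum, h0]
  | succ i ih =>
    rw [hv]
    refine (ih.mul (hk i)).congr fun N => ?_
    rw [psum_succ, mul_add, pow_add]
    push_cast
    rfl

/-- At a basis eigenvalue a polynomial is bounded by the norm in `sphereRep`; by continuity the same
bound holds at every spectral point, and these control `‖f d‖`. -/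
theorem norm_map_le_of_mem_diagSub (hq0 : 0 < q) (hq1 : q < 1) (f : CoordAlg n q →⋆ₐ[ℂ] B)
    {d : CoordAlg n q} (hd : d ∈ CoordAlg.diagSub n q) :
    ‖f d‖ ≤ ‖sphereRep n q hq0.le hq1 d‖ := by
  cases subsingleton_or_nontrivial B with
  | inl _ => rw [Subsingleton.elim (f d) 0, norm_zero]; exact norm_nonneg _
  | inr _ =>
    obtain ⟨p, rfl⟩ := hd
    change ‖f.toAlgHom (FreeAlgebra.lift ℂ CoordAlg.x p)‖ ≤ _
    rw [map_freeLift]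
    refine norm_freeLift_le (fun j => ?_) (fun i j => ?_) (norm_nonneg _) fun v hv => ?_
    · exact (map_star f _).symm.trans (congrArg f (CoordAlg.star_x j))
    · exact (map_mul f _ _).symm.trans
        ((congrArg f (CoordAlg.x_comm hq0.ne' i j)).trans (map_mul f _ _))
    · obtain ⟨k, hk⟩ := IsSpectralPoint.exists_tendsto hq0 hq1 f hv
      exact le_of_tendsto (((continuous_freeLift p).norm.tendsto v).comp hk)
        (Eventually.of_forall fun N => norm_freeLift_psum_le hq0.le hq1 (k N) p)

end DiagonalNorm

end QSphere

namespace QSphere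

/-! ### Integrals over compact spaces and groups -/

section Average

open MeasureTheory

/-- A nonnegative continuous function whose integral vanishes is zero. -/
theorem eq_zero_of_integral_eq_zero {T B : Type*} [TopologicalSpace T] [CompactSpace T]
    [MeasurableSpace T] [BorelSpace T] {μ : Measure T} [IsFiniteMeasure μ] [μ.IsOpenPosMeasure]
    [CStarAlgebra B] [PartialOrder B] [StarOrderedRing B] {h : C(T, B)} (hint : Integrable h μ)
    (h0 : ∀ t, 0 ≤ h t) (hz : ∫ t, h t ∂μ = 0) (s : T) : h s = 0 := by
  by_contra hs
  have hpos : 0 < ‖h s‖ := norm_pos_iff.2 hs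
  let U : Set T := h ⁻¹' Metric.ball (h s) (‖h s‖ / 2)
  have hU : IsOpen U := Metric.isOpen_ball.preimage h.continuous
  have hsU : s ∈ U := Metric.mem_ball_self (half_pos hpos)
  have hμ : 0 < μ.real U :=
    ENNReal.toReal_pos (hU.measure_pos μ ⟨s, hsU⟩).ne' (measure_ne_top _ _)
  -- The integrals over `U` and its complement are both nonnegative and add up to zero.
  have h1 : ∫ t in U, h t ∂μ = 0 := by
    have h2 := integral_add_compl hU.measurableSet hint
    rw [hz] at h2
    have h3 : 0 ≤ ∫ t in U, h t ∂μ := integral_nonneg h0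
    have h4 : 0 ≤ ∫ t in Uᶜ, h t ∂μ := integral_nonneg h0
    exact le_antisymm (by rw [eq_neg_of_add_eq_zero_left h2]; exact neg_nonpos.2 h4) h3
  -- Since `h` integrates to zero over `U`, the left side is `μ(U) * ‖h s‖`, contradicting this
  -- bound.
  have h5 : ‖∫ t in U, (h t - h s) ∂μ‖ ≤ ‖h s‖ / 2 * μ.real U :=
    norm_setIntegral_le_of_norm_le_const (measure_lt_top _ _) fun t ht => by
      rw [← dist_eq_norm]; exact (Metric.mem_ball.1 ht).le
  rw [integral_sub hint.integrableOn (integrable_const _), h1, zero_sub, norm_neg,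
    setIntegral_const, norm_smul, Real.norm_of_nonneg hμ.le] at h5
  nlinarith [mul_pos hμ hpos]

/-- A continuous function that is multiplied by a scalar other than `1` under some translation has
zero integral. -/
theorem integral_eq_zero_of_mul_left {T B : Type*} [Group T] [MeasurableSpace T] [MeasurableMul T]
    {μ : Measure T} [μ.IsMulLeftInvariant] [NormedAddCommGroup B] [NormedSpace ℂ B]
    {h : T → B} {s : T} {c : ℂ} (hc : c ≠ 1) (hs : ∀ t, h (s * t) = c • h t) :
    ∫ t, h t ∂μ = 0 := by
  have h1 := integral_mul_left_eq_self (μ := μ) h s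
  simp_rw [hs] at h1
  rw [integral_smul] at h1
  have h2 : (c - 1) • ∫ t, h t ∂μ = 0 := by rw [sub_smul, one_smul, h1, sub_self]
  exact (smul_eq_zero.1 h2).resolve_left (sub_ne_zero.2 hc)

end Average

/-! ### Torus rotations and their average on the coordinate algebra -/

noncomputable section Torus

open MeasureTheory

/-- The torus that acts on the quantum sphere. -/
abbrev Torus (n : ℕ) : Type := Fin (n + 1) → Circle

variable {n : ℕ} {q : ℝ}

/-- The coordinate function `t ↦ t i • b`. -/
def coordMul {B : Type*} [NormedAddCommGroup B] [NormedSpace ℂ B] (i : Fin (n + 1)) (b : B) :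
    C(Torus n, B) :=
  ⟨fun t => (t i : ℂ) • b,
    (continuous_subtype_val.comp (continuous_apply i)).smul continuous_const⟩

theorem circle_conj_mul (t : Circle) : conj (t : ℂ) * t = 1 := by
  rw [← Circle.coe_inv_eq_conj, ← Circle.coe_mul, inv_mul_cancel, Circle.coe_one]

theorem circle_mul_conj (t : Circle) : (t : ℂ) * conj (t : ℂ) = 1 := by
  rw [mul_comm, circle_conj_mul]

/-- *-homomorphisms out of the coordinate algebra. -/
def CoordAlg.liftStar {B : Type*} [Ring B] [StarRing B] [Algebra ℂ B] [StarModule ℂ B]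
    (u : Fin (n + 1) → B) (hc : ∀ i j, i < j → u j * u i = (q : ℂ) • (u i * u j))
    (hx : ∀ i j, i ≠ j → star (u i) * u j = (q : ℂ) • (u j * star (u i)))
    (hd : ∀ i, star (u i) * u i =
      u i * star (u i) + (1 - (q : ℂ) ^ 2) • ∑ j ∈ Finset.Ioi i, u j * star (u j))
    (hs : ∑ i, u i * star (u i) = 1) : CoordAlg n q →⋆ₐ[ℂ] B where
  __ := CoordAlg.liftAlg u (fun i => star (u i)) hc
    (fun i j h => by
      have h1 := congrArg star (hc i j h)
      rwa [star_mul, star_smul, star_mul, Complex.star_def, Complex.conj_ofReal] at h1) hx hd hs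
  map_star' a := by
    change CoordAlg.liftAlg _ _ _ _ _ _ _ (star a) = star (CoordAlg.liftAlg _ _ _ _ _ _ _ a)
    induction a using CoordAlg.induction with
    | halg c =>
      rw [CoordAlg.star_algebraMap, AlgHom.commutes, AlgHom.commutes, ← Complex.star_def,
        algebraMap_star_comm]
    | hz i => rw [CoordAlg.star_z, CoordAlg.liftAlg_zs, CoordAlg.liftAlg_z]
    | hzs i => rw [CoordAlg.star_zs, CoordAlg.liftAlg_zs, CoordAlg.liftAlg_z, star_star]
    | hmul a b ha hb => rw [star_mul, map_mul, map_mul, star_mul, ha, hb]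
    | hadd a b ha hb => rw [star_add, map_add, map_add, star_add, ha, hb]

theorem CoordAlg.liftStar_z {B : Type*} [Ring B] [StarRing B] [Algebra ℂ B] [StarModule ℂ B]
    (u : Fin (n + 1) → B) (hc : ∀ i j, i < j → u j * u i = (q : ℂ) • (u i * u j))
    (hx : ∀ i j, i ≠ j → star (u i) * u j = (q : ℂ) • (u j * star (u i)))
    (hd : ∀ i, star (u i) * u i =
      u i * star (u i) + (1 - (q : ℂ) ^ 2) • ∑ j ∈ Finset.Ioi i, u j * star (u j))
    (hs : ∑ i, u i * star (u i) = 1) (i : Fin (n + 1)) :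
    CoordAlg.liftStar u hc hx hd hs (CoordAlg.z i) = u i :=
  CoordAlg.liftAlg_z hc (fun i j h => by
      have h1 := congrArg star (hc i j h)
      rwa [star_mul, star_smul, star_mul, Complex.star_def, Complex.conj_ofReal] at h1) hx hd hs i

section Rotate

variable {B : Type*} [CStarAlgebra B] (f : CoordAlg n q →⋆ₐ[ℂ] B)

/-- The rotated generator `t ↦ t i • f (z i)`. -/
def rotGen (i : Fin (n + 1)) : C(Torus n, B) := coordMul i (f (CoordAlg.z i))

theorem rotGen_apply (i : Fin (n + 1)) (t : Torus n) :
    rotGen f i t = (t i : ℂ) • f (CoordAlg.z i) := rfl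

theorem star_rotGen_apply (i : Fin (n + 1)) (t : Torus n) :
    star (rotGen f i) t = conj (t i : ℂ) • f (CoordAlg.zs i) := by
  rw [ContinuousMap.star_apply, rotGen_apply, star_smul, ← map_star, CoordAlg.star_z]
  rfl

theorem sum_rotGen_apply (s : Finset (Fin (n + 1))) (t : Torus n) :
    (∑ i ∈ s, rotGen f i * star (rotGen f i)) t =
      f (∑ i ∈ s, CoordAlg.z i * CoordAlg.zs i) := by
  rw [ContinuousMap.sum_apply, map_sum]
  refine Finset.sum_congr rfl fun i _ => ?_
  rw [ContinuousMap.mul_apply, star_rotGen_apply, rotGen_apply, smul_mul_smul_comm,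
    circle_mul_conj, one_smul, map_mul]

/-- A *-homomorphism from the coordinate algebra, rotated by the torus. -/
def rotate : CoordAlg n q →⋆ₐ[ℂ] C(Torus n, B) :=
  CoordAlg.liftStar (rotGen f)
    (fun i j h => by
      ext t
      simp only [ContinuousMap.mul_apply, ContinuousMap.smul_apply, rotGen_apply,
        smul_mul_smul_comm]
      rw [← map_mul, CoordAlg.rel_comm h, map_smul, map_mul, smul_comm, mul_comm (t j : ℂ)])
    (fun i j h => by
      ext t
      simp only [ContinuousMap.mul_apply, ContinuousMap.smul_apply, star_rotGen_apply,
        rotGen_apply, smul_mul_smul_comm]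
      rw [← map_mul, CoordAlg.rel_cross h, map_smul, map_mul, smul_comm, mul_comm (t j : ℂ)])
    (fun i => by
      ext t
      rw [ContinuousMap.add_apply, ContinuousMap.smul_apply, sum_rotGen_apply,
        ContinuousMap.mul_apply, ContinuousMap.mul_apply, star_rotGen_apply, rotGen_apply,
        smul_mul_smul_comm, smul_mul_smul_comm, circle_conj_mul, circle_mul_conj, one_smul,
        one_smul, ← map_mul, ← map_mul, ← map_smul, ← map_add, ← CoordAlg.rel_diag])
    (by
      ext t
      rw [sum_rotGen_apply, CoordAlg.rel_sphere, map_one]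
      rfl)

theorem rotate_z (i : Fin (n + 1)) (t : Torus n) :
    rotate f (CoordAlg.z i) t = (t i : ℂ) • f (CoordAlg.z i) :=
  DFunLike.congr_fun (CoordAlg.liftStar_z (rotGen f) _ _ _ _ i) t

theorem rotate_zs (i : Fin (n + 1)) (t : Torus n) :
    rotate f (CoordAlg.zs i) t = ((t i)⁻¹ : Circle) • f (CoordAlg.zs i) := by
  rw [← CoordAlg.star_z, map_star, map_star, ContinuousMap.star_apply, rotate_z, star_smul,
    Circle.smul_def, Circle.coe_inv_eq_conj]
  rfl

theorem rotate_one (a : CoordAlg n q) : rotate f a 1 = f a := by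
  induction a using CoordAlg.induction with
  | halg c => rw [AlgHomClass.commutes, AlgHomClass.commutes]; rfl
  | hz i => rw [rotate_z, Pi.one_apply, Circle.coe_one, one_smul]
  | hzs i => rw [rotate_zs, Pi.one_apply, inv_one, one_smul]
  | hmul a b ha hb => rw [map_mul, map_mul, ContinuousMap.mul_apply, ha, hb]
  | hadd a b ha hb => rw [map_add, map_add, ContinuousMap.add_apply, ha, hb]

theorem rotate_x (j : Fin (n + 1)) (t : Torus n) :
    rotate f (CoordAlg.x j) t = f (CoordAlg.x j) := by
  rw [CoordAlg.x, map_sum, map_sum, ContinuousMap.sum_apply]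
  refine Finset.sum_congr rfl fun l _ => ?_
  rw [map_mul, map_mul, ContinuousMap.mul_apply, rotate_z, rotate_zs, Circle.smul_def,
    smul_mul_smul_comm, ← Circle.coe_mul, mul_inv_cancel, Circle.coe_one, one_smul]

theorem rotate_of_mem_diagSub {d : CoordAlg n q} (hd : d ∈ CoordAlg.diagSub n q) (t : Torus n) :
    rotate f d t = f d := by
  obtain ⟨p, rfl⟩ := hd
  change rotate f (FreeAlgebra.lift ℂ CoordAlg.x p) t = f (FreeAlgebra.lift ℂ CoordAlg.x p)
  induction p using FreeAlgebra.induction with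
  | grade0 c =>
    rw [AlgHom.commutes, AlgHomClass.commutes, AlgHomClass.commutes]; rfl
  | grade1 j => rw [FreeAlgebra.lift_ι_apply, rotate_x]
  | mul a b ha hb => rw [map_mul, map_mul, map_mul, ContinuousMap.mul_apply, ha, hb]
  | add a b ha hb => rw [map_add, map_add, map_add, ContinuousMap.add_apply, ha, hb]

theorem rotate_zpow (i : Fin (n + 1)) (m : ℤ) (t : Torus n) :
    rotate f (CoordAlg.zpow i m) t = (t i ^ m) • f (CoordAlg.zpow i m) := by
  cases m with
  | ofNat m =>
    simp only [CoordAlg.zpow, map_pow, ContinuousMap.pow_apply, rotate_z, smul_pow,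
      Circle.smul_def, Int.ofNat_eq_natCast, zpow_natCast, Circle.coe_pow]
  | negSucc m =>
    simp only [CoordAlg.zpow, map_pow, ContinuousMap.pow_apply, rotate_zs, smul_pow,
      zpow_negSucc, inv_pow]

theorem rotate_monomial (m : Fin (n + 1) → ℤ) (l : List (Fin (n + 1))) (t : Torus n) :
    rotate f (CoordAlg.monomial m l) t =
      (l.map fun i => t i ^ m i).prod • f (CoordAlg.monomial m l) := by
  induction l with
  | nil => simp [CoordAlg.monomial]
  | cons i l ih =>
    rw [CoordAlg.monomial_cons, map_mul, map_mul, ContinuousMap.mul_apply, rotate_zpow, ih,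
      List.map_cons, List.prod_cons, smul_mul_smul_comm]

end Rotate

/-- The witness `exp(iπ/m)` has `m`-th power `-1`. -/
theorem exists_circle_zpow_ne_one {m : ℤ} (hm : m ≠ 0) : ∃ c : Circle, c ^ m ≠ 1 := by
  refine ⟨Circle.exp (Real.pi / m), fun h => ?_⟩
  have h1 := congrArg (fun c : Circle => (c : ℂ)) h
  have hm' : (m : ℂ) ≠ 0 := by exact_mod_cast hm
  simp only [Circle.coe_zpow, Circle.coe_exp, Circle.coe_one, ← Complex.exp_int_mul] at h1
  have h2 : (m : ℂ) * (((Real.pi / m : ℝ) : ℂ) * Complex.I) = Real.pi * Complex.I := by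
    push_cast; field_simp
  rw [h2, Complex.exp_pi_mul_I] at h1
  norm_num at h1

theorem exists_torus_prod_ne_one {m : Fin (n + 1) → ℤ} (hm : m ≠ 0) :
    ∃ s : Torus n, ((List.finRange (n + 1)).map fun i => s i ^ m i).prod ≠ 1 := by
  obtain ⟨i, hi⟩ := Function.ne_iff.1 hm
  obtain ⟨c, hc⟩ := exists_circle_zpow_ne_one hi
  refine ⟨Pi.mulSingle i c, ?_⟩
  rw [← Fin.prod_univ_def, Finset.prod_eq_single i]
  · rwa [Pi.mulSingle_eq_same]
  · intro j _ hj
    rw [Pi.mulSingle_eq_of_ne hj, one_zpow]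
  · simp

variable {B : Type*} [CStarAlgebra B] (f : CoordAlg n q →⋆ₐ[ℂ] B)
  [MeasurableSpace (Torus n)] [BorelSpace (Torus n)]

/-- The average over the torus maps the coordinate algebra to the diagonal subalgebra. -/
theorem integral_rotate_mem (hq : q ≠ 0) (μ : Measure (Torus n)) [IsFiniteMeasure μ]
    [μ.IsMulLeftInvariant] (a : CoordAlg n q) :
    ∃ d ∈ CoordAlg.diagSub n q, ∫ t, rotate f a t ∂μ = f d := by
  have hint : ∀ a, Integrable (rotate f a) μ := fun a =>
    (rotate f a).continuous.integrable_of_hasCompactSupport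
      (HasCompactSupport.of_compactSpace _)
  have ha : a ∈ CoordAlg.monomialSpan n q := by
    rw [CoordAlg.monomialSpan_eq_top hq]; exact Submodule.mem_top
  induction ha using Submodule.span_induction with
  | mem a ha =>
    obtain ⟨d, hd, m, rfl⟩ := ha
    by_cases hm : m = 0
    · subst hm
      -- Elements of `diagSub` are fixed by the rotation; the total mass appears because `μ` is not
      -- assumed normalised.
      refine ⟨(μ.real Set.univ : ℂ) • d, Subalgebra.smul_mem _ hd _, ?_⟩
      rw [CoordAlg.monomial_zero, mul_one]
      simp_rw [rotate_of_mem_diagSub f hd]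
      rw [integral_const, map_smul, Complex.coe_smul]
    · refine ⟨0, zero_mem _, ?_⟩
      -- The monomial transforms by a nontrivial character of the torus; translating by an `s` where
      -- the character is not `1` shows that its average vanishes.
      obtain ⟨s, hs⟩ := exists_torus_prod_ne_one hm
      rw [map_zero]
      have hv : ∀ t, rotate f (d * CoordAlg.monomial m (List.finRange (n + 1))) t =
          f d * ((List.finRange (n + 1)).map fun i => t i ^ m i).prod •
            f (CoordAlg.monomial m (List.finRange (n + 1))) := fun t => by
        rw [map_mul (rotate f), ContinuousMap.mul_apply, rotate_of_mem_diagSub f hd,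
          rotate_monomial]
      refine integral_eq_zero_of_mul_left (s := s)
        (c := ((((List.finRange (n + 1)).map fun i => s i ^ m i).prod : Circle) : ℂ))
        (fun h => hs (Circle.ext h)) fun t => ?_
      rw [hv, hv]
      refine Eq.trans ?_ (Circle.smul_def _ _)
      rw [← mul_smul_comm, smul_smul, ← List.prod_map_mul]
      simp only [Pi.mul_apply, mul_zpow]
  | zero => exact ⟨0, zero_mem _, by simp⟩
  | add a b _ _ ha hb =>
    obtain ⟨d, hd, h⟩ := ha
    obtain ⟨e, he, h'⟩ := hb
    refine ⟨d + e, add_mem hd he, ?_⟩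
    simp only [map_add, ContinuousMap.add_apply]
    rw [integral_add (hint a) (hint b), h, h']
  | smul c a _ ha =>
    obtain ⟨d, hd, h⟩ := ha
    refine ⟨c • d, Subalgebra.smul_mem _ hd c, ?_⟩
    simp only [map_smul, ContinuousMap.smul_apply]
    rw [integral_smul, h]

end Torus

end QSphere

namespace QSphere

/-! ### Covariance of the representation, and faithfulness -/

noncomputable section Faithful

open MeasureTheory

variable {n : ℕ} {q : ℝ}

/-- The diagonal operator with diagonal entries `w` of modulus one. -/
def phaseOp (w : Idx n → Circle) : HSpace n →L[ℂ] HSpace n :=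
  have hle : ∀ (f : HSpace n) (k : Idx n), ‖(w k : ℂ) * f k‖ ≤ ‖f k‖ := fun f k => by
    rw [norm_mul, Circle.norm_coe, one_mul]
  LinearMap.mkContinuous
    { toFun := fun f => ⟨fun k => (w k : ℂ) * f k, (lp.memℓp f).mono' (hle f)⟩
      map_add' := fun f g => by ext k; exact mul_add _ _ _
      map_smul' := fun c f => by ext k; exact mul_left_comm _ _ _ } 1
    (fun f => by
      rw [one_mul]
      exact lp.norm_mono (by norm_num) (hle f))

theorem phaseOp_ket (w : Idx n → Circle) (k : Idx n) :
    phaseOp w (ket k) = (w k : ℂ) • ket k := by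
  ext j
  change (w j : ℂ) * ket k j = (w k : ℂ) * ket k j
  rw [ket_apply]
  split_ifs with h
  · rw [h]
  · simp

/-- The phase `t_0 ^ k_0 ⋯ t_n ^ k_n`. -/
def phase (t : Torus n) (k : Idx n) : Circle :=
  (∏ i : Fin n, t i.castSucc ^ k.1 i) * t (Fin.last n) ^ k.2

theorem phase_raise (t : Torus n) (i : Fin (n + 1)) (k : Idx n) :
    phase t (raise i k) = t i * phase t k := by
  induction i using Fin.lastCases with
  | last => rw [raise_last, phase, phase, zpow_add_one, mul_comm (t _ ^ k.2), mul_left_comm]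
  | cast i =>
    rw [raise_castSucc, phase, phase, ← mul_assoc]
    congr 1
    dsimp only
    rw [← Finset.mul_prod_erase _ _ (Finset.mem_univ i),
      ← Finset.mul_prod_erase (a := i) _ (fun i => t i.castSucc ^ k.1 i) (Finset.mem_univ i),
      Function.update_self, pow_succ', mul_assoc]
    congr 2
    exact Finset.prod_congr rfl fun j hj => by
      rw [Function.update_of_ne (Finset.ne_of_mem_erase hj)]

/-- Raising the label `i` multiplies the phase by `t i`. -/
theorem phaseOp_mul_zOp (hq0 : 0 ≤ q) (hq1 : q < 1) (t : Torus n) (i : Fin (n + 1)) :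
    phaseOp (phase t) * zOp hq0 hq1 i = ((t i : ℂ) • zOp hq0 hq1 i) * phaseOp (phase t) := by
  refine op_ext fun k => ?_
  rw [mul_op_apply, mul_op_apply, smul_op_apply, zOp_ket, phaseOp_ket, map_smul, map_smul,
    phaseOp_ket, zOp_ket, smul_smul, smul_smul, smul_smul, phase_raise, Circle.coe_mul]
  congr 1
  ring

theorem phaseOp_mul_star_zOp (hq0 : 0 ≤ q) (hq1 : q < 1) (t : Torus n) (i : Fin (n + 1)) :
    phaseOp (phase t) * star (zOp hq0 hq1 i) =
      star ((t i : ℂ) • zOp hq0 hq1 i) * phaseOp (phase t) := by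
  refine op_ext fun k => ?_
  rw [mul_op_apply, mul_op_apply, star_smul, smul_op_apply, adjoint_zOp_ket, phaseOp_ket,
    map_smul, map_smul, phaseOp_ket, adjoint_zOp_ket, smul_smul, smul_smul, smul_smul]
  by_cases h : raise i (lower i k) = k
  · congr 1
    rw [← h, phase_raise, h, Circle.coe_mul, Complex.star_def]
    linear_combination -((coweight q i k : ℂ) * phase t (lower i k)) * circle_conj_mul (t i)
  -- When a zero label cannot be lowered, the phase relation fails but the coefficient vanishes.
  · simp [coweight_eq_zero h]

/-- The canonical *-homomorphism to the universal C*-algebra of the coordinate algebra. -/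
abbrev toSphere (n : ℕ) (q : ℝ) : CoordAlg n q →⋆ₐ[ℂ] CSphere n q := toUniversal (CoordAlg n q)

/-- Makes the torus average continuous, so that estimates on the coordinate algebra extend to its
completion. -/
theorem continuous_integral_continuousMap {T E : Type*} [TopologicalSpace T] [CompactSpace T]
    [MeasurableSpace T] [BorelSpace T] [SecondCountableTopology T] (μ : Measure T)
    [IsFiniteMeasure μ] [NormedAddCommGroup E] [NormedSpace ℂ E] :
    Continuous fun g : C(T, E) => ∫ t, g t ∂μ := by
  have hint : ∀ g : C(T, E), Integrable g μ := fun g =>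
    g.continuous.integrable_of_hasCompactSupport (HasCompactSupport.of_compactSpace _)
  refine continuous_of_linear_of_bound (𝕜 := ℂ) (C := μ.real Set.univ)
    (fun g h => ?_) (fun c g => ?_) fun g => ?_
  · exact integral_add (hint g) (hint h)
  · exact integral_smul c g
  · rw [mul_comm]
    exact norm_integral_le_of_norm_le_const (Filter.Eventually.of_forall g.norm_coe_le_norm)

theorem denseRange_toSphere : DenseRange (toSphere n q) :=
  (universalSeminorm (CoordAlg n q)).denseRange_toCompl

/-- The action of the torus on the quantum sphere. -/
def torusAct (n : ℕ) (q : ℝ) : CSphere n q →⋆ₐ[ℂ] C(Torus n, CSphere n q) :=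
  (universal_property (rotate (toSphere n q))).choose

/-- All rotations are packed into one *-homomorphism to the C*-algebra `C(Torus n, CSphere n q)`, so
the universal property gives the action and its continuity in `t` together. -/
theorem torusAct_toSphere (a : CoordAlg n q) :
    torusAct n q (toSphere n q a) = rotate (toSphere n q) a :=
  DFunLike.congr_fun (universal_property (rotate (toSphere n q))).choose_spec.1 a

theorem continuous_torusAct : Continuous (torusAct n q) := continuous_starAlgHom _

theorem torusAct_one (b : CSphere n q) : torusAct n q b 1 = b := by
  refine congrFun ((denseRange_toSphere (n := n) (q := q)).equalizer
    ((continuous_eval_const (1 : Torus n)).comp continuous_torusAct)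
    continuous_id (funext fun a => ?_)) b
  change torusAct n q (toSphere n q a) 1 = toSphere n q a
  rw [torusAct_toSphere, rotate_one]

variable {hq0 : 0 ≤ q} {hq1 : q < 1} {π : CSphere n q →⋆ₐ[ℂ] (HSpace n →L[ℂ] HSpace n)}

/-- Covariance: both sides are continuous in `b`, and on the dense coordinate algebra the relation
follows from the generators. -/
theorem phaseOp_mul_map (hπ : π.comp (toSphere n q) = sphereRep n q hq0 hq1) (t : Torus n)
    (b : CSphere n q) :
    phaseOp (phase t) * π b = π (torusAct n q b t) * phaseOp (phase t) := by
  have hπa : ∀ a, π (toSphere n q a) = sphereRep n q hq0 hq1 a := fun a => DFunLike.congr_fun hπ a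
  have hc : Continuous π := continuous_starAlgHom π
  refine congrFun (denseRange_toSphere.equalizer (continuous_const.mul hc)
    ((hc.comp ((continuous_eval_const t).comp continuous_torusAct)).mul
      continuous_const) (funext fun a => ?_)) b
  change phaseOp (phase t) * π (toSphere n q a) =
    π (torusAct n q (toSphere n q a) t) * phaseOp (phase t)
  have hz : ∀ i, π (torusAct n q (toSphere n q (CoordAlg.z i)) t) = (t i : ℂ) • zOp hq0 hq1 i :=
    fun i => by rw [torusAct_toSphere, rotate_z, map_smul, hπa, sphereRep_z]
  induction a using CoordAlg.induction with
  | halg c =>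
    have h : torusAct n q (algebraMap ℂ _ c) t = algebraMap ℂ _ c := by
      rw [AlgHomClass.commutes]; rfl
    rw [AlgHomClass.commutes, h, AlgHomClass.commutes, Algebra.commutes]
  | hz i => rw [hz, hπa, sphereRep_z, phaseOp_mul_zOp]
  | hzs i =>
    rw [← CoordAlg.star_z, map_star, map_star, map_star, ContinuousMap.star_apply, map_star, hz,
      hπa, sphereRep_z, phaseOp_mul_star_zOp]
  | hmul a b ha hb =>
    rw [map_mul, map_mul, map_mul, ContinuousMap.mul_apply, map_mul, ← mul_assoc, ha, mul_assoc,
      hb, mul_assoc]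
  | hadd a b ha hb =>
    rw [map_add, map_add, map_add, ContinuousMap.add_apply, map_add, mul_add, add_mul, ha, hb]

theorem map_torusAct_eq_zero (hπ : π.comp (toSphere n q) = sphereRep n q hq0 hq1) (t : Torus n)
    {b : CSphere n q} (hb : π b = 0) : π (torusAct n q b t) = 0 := by
  refine op_ext fun k => ?_
  have h := DFunLike.congr_fun (phaseOp_mul_map hπ t b) (ket k)
  rw [hb, mul_zero, mul_op_apply, phaseOp_ket, map_smul] at h
  -- The phase operator only rescales `ket k` by a nonzero number, so its invertibility is not
  -- needed.
  exact (smul_eq_zero.1 h.symm).resolve_left (Circle.coe_ne_zero _)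

theorem integral_torusAct_eq_zero (hq0 : 0 < q)
    (hπ : π.comp (toSphere n q) = sphereRep n q hq0.le hq1) [MeasurableSpace (Torus n)]
    [BorelSpace (Torus n)] (μ : Measure (Torus n)) [IsFiniteMeasure μ] [μ.IsMulLeftInvariant]
    {b : CSphere n q} (hb : π b = 0) : ∫ t, torusAct n q b t ∂μ = 0 := by
  have hint : ∀ b, Integrable (torusAct n q b) μ := fun b =>
    (torusAct n q b).continuous.integrable_of_hasCompactSupport
      (HasCompactSupport.of_compactSpace _)
  have hc : Continuous π := continuous_starAlgHom π
  let L : CSphere n q →L[ℂ] (HSpace n →L[ℂ] HSpace n) := ⟨π.toAlgHom.toLinearMap, hc⟩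
  have h1 : π (∫ t, torusAct n q b t ∂μ) = 0 := by
    refine (L.integral_comp_comm (hint b)).symm.trans ?_
    exact integral_eq_zero_of_ae (Filter.Eventually.of_forall fun t => map_torusAct_eq_zero hπ t hb)
  have hcont : Continuous fun b => ∫ t, torusAct n q b t ∂μ :=
    (continuous_integral_continuousMap μ).comp continuous_torusAct
  -- A closed condition on `b`; on the coordinate algebra the average is the image of an element of
  -- `diagSub`, where the norm comparison applies.
  have h2 : ∀ b, ‖∫ t, torusAct n q b t ∂μ‖ ≤ ‖π (∫ t, torusAct n q b t ∂μ)‖ := by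
    intro b
    refine denseRange_toSphere.induction_on
      (p := fun b => ‖∫ t, torusAct n q b t ∂μ‖ ≤ ‖π (∫ t, torusAct n q b t ∂μ)‖) b
      (isClosed_le hcont.norm (hc.comp hcont).norm) fun a => ?_
    obtain ⟨d, hd, h⟩ := integral_rotate_mem (toSphere n q) hq0.ne' μ a
    rw [torusAct_toSphere, h]
    exact (norm_map_le_of_mem_diagSub hq0 hq1 (toSphere n q) hd).trans_eq
      (congrArg norm (DFunLike.congr_fun hπ d).symm)
  have h3 := h2 b
  rw [h1, norm_zero] at h3
  exact norm_le_zero_iff.1 h3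

theorem injective_of_comp_eq (hq0 : 0 < q)
    (hπ : π.comp (toSphere n q) = sphereRep n q hq0.le hq1) : Function.Injective π := by
  refine (injective_iff_map_eq_zero π).2 fun a ha => ?_
  let _ : MeasurableSpace (Torus n) := borel _
  have _ : BorelSpace (Torus n) := ⟨rfl⟩
  let _ := CStarAlgebra.spectralOrder (CSphere n q)
  have _ := CStarAlgebra.spectralOrderedRing (CSphere n q)
  -- Passing to `star a * a` makes the rotated function positive, so its zero average forces it to
  -- vanish everywhere, in particular at `t = 1`.
  have hb : π (star a * a) = 0 := by rw [map_mul, ha, mul_zero]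
  have h := eq_zero_of_integral_eq_zero (μ := Measure.haar) (h := torusAct n q (star a * a))
    ((torusAct n q (star a * a)).continuous.integrable_of_hasCompactSupport
      (HasCompactSupport.of_compactSpace _))
    (fun t => by
      rw [map_mul, map_star, ContinuousMap.mul_apply, ContinuousMap.star_apply]
      exact star_mul_self_nonneg _)
    (integral_torusAct_eq_zero hq0 hπ Measure.haar hb) 1
  rw [torusAct_one] at h
  exact CStarRing.star_mul_self_eq_zero_iff a |>.1 h

end Faithful

end QSphere

theorem mainTheorem6 (n : ℕ) (q : ℝ) (hq0 : 0 < q) (hq1 : q < 1) :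
    ∃ π : QSphere.CSphere n q →⋆ₐ[ℂ] (QSphere.HSpace n →L[ℂ] QSphere.HSpace n),
      π.comp (QSphere.toUniversal (QSphere.CoordAlg n q)) =
          QSphere.sphereRep n q hq0.le hq1 ∧
        (∀ ρ : QSphere.CSphere n q →⋆ₐ[ℂ] (QSphere.HSpace n →L[ℂ] QSphere.HSpace n),
          ρ.comp (QSphere.toUniversal (QSphere.CoordAlg n q)) =
            QSphere.sphereRep n q hq0.le hq1 → ρ = π) ∧
        Function.Injective π := by
  obtain ⟨π, hπ, huniq⟩ := QSphere.universal_property (QSphere.sphereRep n q hq0.le hq1)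
  exact ⟨π, hπ, huniq, QSphere.injective_of_comp_eq hq0 hπ⟩
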